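/- Let $\mathsf X$ be a Polish space with its Borel $\sigma$-field, $\mu$ a measure on $\mathsf X$, $\pi$ a probability density with respect to $\mu$; write $\pi$ also for the distribution $\pi\,d\mu$, and $\|\pi\|_\infty=\sup_{\mathsf X}\pi$. Let $T>1$, $\upsilon\in(0,1)$, $\tau\in(0,1/T)$, assume $\int\pi^{1/T}d\mu<\infty$, and let $\theta_\star$ be the probability distribution with $\mu$-density proportional to $\pi^{1/T}$. Put $W(x)=(\pi(x)/\|\pi\|_\infty)^{-\tau}$. Let $P$ be a Markov transition kernel on $\mathsf X$. For a probability measure $\theta$ on $\mathsf X$ let $P_\theta(x,\cdot)=(1-\upsilon)P(x,\cdot)+\upsilon K_\theta(x,\cdot)$, where $$K_\theta(x,A)=\int_A\alpha(x,y)\,\theta(dy)+\mathbf 1_A(x)\int\{1-\alpha(x,y)\}\,\theta(dy),\qquad \alpha(x,y)=1\wedge\frac{\pi(y)^{\beta}}{\pi(x)^{\beta}},\quad \beta=1-\frac1T .$$ Let $(X_n)_{n\ge0}$ and $(Y_n)_{n\ge0}$ be $\mathsf X$-valued processes on a filtered probability space $(\Omega,\mathcal A,(\mathcal F_n),\mathbb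 P)$, both adapted to $(\mathcal F_n)$. Put $\theta_n=(n+1)^{-1}\sum_{k=0}^n\delta_{Y_k}$ and suppose that $\mathbb E[f(X_{n+1})\mid\mathcal F_n]=P_{\theta_n}f(X_n)$ almost surely for every $n\ge0$ and every bounded measurable $f$ (two-level interacting tempering sampler). Assume: (I1) $\pi$ is continuous, everywhere positive and $\|\pi\|_\infty<\infty$. (I2) (a) $P$ is $\pi$-irreducible, aperiodic and Feller, and $\pi P=\pi$; (b) there are $\lambda\in(0,1)$ and $b<\infty$ with $PW\le\lambda W+b$; (c) for every $p\in(0,\|\pi\|_\infty)$ the set $\{\pi\ge p\}$ is $1$-small for $P$, that is, there is a nonzero measure $\nu$ with $P(x,\cdot)\ge\nu$ for all $x\in\{\pi\ge p\}$. (I3) (a) $\theta_\star(W)<\infty$ and, for every continuous $f$ with $\sup_{\mathsf X}|f|/W<\infty$, $\theta_n(f)\to\theta_\star(f)$ almost surely; (b) $\sup_n\mathbb E[W(Y_n)]<\infty$. Suppose moreover that $\mathbb E[W(X_0)]<\infty$. Then, for every bounded continuous function $f:\mathsf X\to\mathbb R$, $$\lim_{n\to\infty}\mathbb E[f(X_n)]=\pi(f)=\int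 f\,\pi\,d\mu .$$ -/

import Mathlib

open MeasureTheory ProbabilityTheory Filter Topology BoundedContinuousFunction

namespace InteractingTempering

variable {X : Type*} [MeasurableSpace X]

/-! ### Notions for Markov transition kernels -/

/-- A `ψ`-irreducible kernel `P` is aperiodic when it has no cycle of length `d ≥ 2`. A `d`-cycle is
a family of `d` pairwise disjoint measurable sets, indexed cyclically, such that `P` moves from each
of them to the next one with probability one and whose union has a `ψ`-null complement. (`ψ` has to
be a maximal irreducibility measure, which an invariant irreducibility measure always is.) -/
def IsAperiodic (ψ : Measure X) (P : Kernel X X) : Prop :=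
  ¬ ∃ (d : ℕ) (D : ZMod d → Set X), 2 ≤ d ∧ (∀ i, MeasurableSet (D i)) ∧
    Pairwise (fun i j => Disjoint (D i) (D j)) ∧
    (∀ i, ∀ x ∈ D i, P x (D (i + 1)) = 1) ∧ ψ (⋃ i, D i)ᶜ = 0

/-- The (weak) Feller property: `P` maps bounded continuous functions to continuous functions
(which are automatically bounded). -/
def IsFeller [TopologicalSpace X] (P : Kernel X X) : Prop :=
  ∀ f : X →ᵇ ℝ, Continuous fun x => ∫ y, f y ∂(P x)

/-- `C` is `1`-small for `P`: one step from `C` is bounded below by a nontrivial measure. -/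
def IsOneSmall (P : Kernel X X) (C : Set X) : Prop :=
  ∃ ν : Measure X, ν ≠ 0 ∧ ∀ x ∈ C, ∀ A, MeasurableSet A → ν A ≤ P x A

/-! ### The target, the tempered target and the drift function -/

/-- The measure with density `π` with respect to `μ`. -/
noncomputable def target (μ : Measure X) (π : X → ℝ) : Measure X :=
  μ.withDensity fun x => ENNReal.ofReal (π x)

/-- The integral `∫ π ^ (1 / T) dμ`. -/
noncomputable def temperedMass (μ : Measure X) (π : X → ℝ) (T : ℝ) : ENNReal :=
  ∫⁻ x, ENNReal.ofReal (π x ^ (1 / T)) ∂μ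

/-- The distribution `θ⋆` with density proportional to `π ^ (1 / T)` with respect to `μ`. -/
noncomputable def temperedTarget (μ : Measure X) (π : X → ℝ) (T : ℝ) : Measure X :=
  (temperedMass μ π T)⁻¹ • μ.withDensity fun x => ENNReal.ofReal (π x ^ (1 / T))

/-- `W(x) = (π(x) / ‖π‖_∞) ^ (-τ)`. -/
noncomputable def driftW (π : X → ℝ) (τ : ℝ) (x : X) : ℝ :=
  (π x / ⨆ z, π z) ^ (-τ)

/-! ### The two-level interacting tempering sampler -/

/-- The acceptance ratio `α(x,y) = 1 ∧ (π(y)^β / π(x)^β)`, with `β = 1 - 1/T`. -/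
noncomputable def acceptance (π : X → ℝ) (T : ℝ) (x y : X) : ℝ :=
  min 1 (π y ^ (1 - 1 / T) / π x ^ (1 - 1 / T))

/-- `K_θ(x, A) = ∫_A α(x,y) θ(dy) + 1_A(x) ∫ (1 - α(x,y)) θ(dy)`. -/
noncomputable def interactionStep (π : X → ℝ) (T : ℝ) (θ : Measure X) (x : X) : Measure X :=
  θ.withDensity (fun y => ENNReal.ofReal (acceptance π T x y)) +
    (∫⁻ y, ENNReal.ofReal (1 - acceptance π T x y) ∂θ) • Measure.dirac x

/-- `P_θ(x, ·) = (1 - υ) P(x, ·) + υ K_θ(x, ·)`. -/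
noncomputable def samplerStep (P : Kernel X X) (π : X → ℝ) (T υ : ℝ) (θ : Measure X) (x : X) :
    Measure X :=
  ENNReal.ofReal (1 - υ) • P x + ENNReal.ofReal υ • interactionStep π T θ x

/-- The empirical distribution `(n + 1)⁻¹ ∑_{k ≤ n} δ_{y k}`. -/
noncomputable def empirical (y : ℕ → X) (n : ℕ) : Measure X :=
  ((n : ENNReal) + 1)⁻¹ • ∑ k ∈ Finset.range (n + 1), Measure.dirac (y k)

/-- `(Xs n)` is produced by the two-level interacting tempering sampler from the auxiliary process
`(Ys n)`: both processes are adapted to `ℱ` and, given `ℱ n`, the law of `Xs (n + 1)` is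
`P_{θ_n}(Xs n, ·)`, where `θ_n` is the empirical distribution of `Ys 0, …, Ys n`. -/
structure IsSampler {Ω : Type*} {mΩ : MeasurableSpace Ω} (Pr : Measure Ω) (ℱ : Filtration ℕ mΩ)
    (P : Kernel X X) (π : X → ℝ) (T υ : ℝ) (Xs Ys : ℕ → Ω → X) : Prop where
  adapted_X : Adapted ℱ Xs
  adapted_Y : Adapted ℱ Ys
  transition : ∀ (n : ℕ) (f : X → ℝ), Measurable f → (∃ C : ℝ, ∀ x, |f x| ≤ C) →
    Pr[fun ω => f (Xs (n + 1) ω) | ℱ n] =ᵐ[Pr]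
      fun ω => ∫ z, f z ∂(samplerStep P π T υ (empirical (fun k => Ys k ω) n) (Xs n ω))

/-! ### The assumptions -/

/-- `π` is a continuous, positive and bounded probability density with respect to `μ`. -/
structure TargetCondition [TopologicalSpace X] (μ : Measure X) (π : X → ℝ) : Prop where
  continuous : Continuous π
  pos : ∀ x, 0 < π x
  bounded : BddAbove (Set.range π)
  density : ∫⁻ x, ENNReal.ofReal (π x) ∂μ = 1

/-- The conditions on the kernel `P`; `τ` is the exponent in the drift function `W`. -/
structure KernelCondition [TopologicalSpace X] (μ : Measure X) (π : X → ℝ) (τ : ℝ)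
    (P : Kernel X X) : Prop where
  irreducible : Kernel.IsIrreducible (target μ π) P
  aperiodic : IsAperiodic (target μ π) P
  feller : IsFeller P
  invariant : Kernel.Invariant P (target μ π)
  drift : ∃ lam b : ℝ, 0 < lam ∧ lam < 1 ∧ ∀ x,
    ∫⁻ y, ENNReal.ofReal (driftW π τ y) ∂(P x) ≤ ENNReal.ofReal (lam * driftW π τ x + b)
  levelSets : ∀ p : ℝ, 0 < p → p < ⨆ z, π z → IsOneSmall P {x | p ≤ π x}

/-- The conditions on the auxiliary process. -/
structure AuxiliaryCondition [TopologicalSpace X] {Ω : Type*} {mΩ : MeasurableSpace Ω}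
    (Pr : Measure Ω) (μ : Measure X) (π : X → ℝ) (T τ : ℝ) (Ys : ℕ → Ω → X) : Prop where
  tempered_W : ∫⁻ x, ENNReal.ofReal (driftW π τ x) ∂(temperedTarget μ π T) < ⊤
  lln : ∀ f : X → ℝ, Continuous f → (∃ C : ℝ, ∀ x, |f x| ≤ C * driftW π τ x) →
    ∀ᵐ ω ∂Pr, Tendsto (fun n => ∫ x, f x ∂(empirical (fun k => Ys k ω) n)) atTop
      (𝓝 (∫ x, f x ∂(temperedTarget μ π T)))
  moment_W : ⨆ n, ∫⁻ ω, ENNReal.ofReal (driftW π τ (Ys n ω)) ∂Pr < ⊤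

end InteractingTempering

namespace InteractingTempering

section Basic

variable {X : Type*} {π : X → ℝ} {T τ : ℝ}

lemma acceptance_nonneg (hpos : ∀ x, 0 < π x) (x y : X) : 0 ≤ acceptance π T x y :=
  le_min zero_le_one
    (div_nonneg (Real.rpow_nonneg (hpos y).le _) (Real.rpow_nonneg (hpos x).le _))

lemma acceptance_le_one (x y : X) : acceptance π T x y ≤ 1 := min_le_left _ _

lemma abs_acceptance_le_one (hpos : ∀ x, 0 < π x) (x y : X) : |acceptance π T x y| ≤ 1 := by
  rw [abs_of_nonneg (acceptance_nonneg hpos x y)]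
  exact acceptance_le_one x y

lemma continuous_acceptance [TopologicalSpace X] (hc : Continuous π) (hpos : ∀ x, 0 < π x) :
    Continuous fun p : X × X => acceptance π T p.1 p.2 := by
  unfold acceptance
  refine continuous_const.min (Continuous.div ?_ ?_ ?_)
  · exact (hc.comp continuous_snd).rpow_const fun p => Or.inl (hpos _).ne'
  · exact (hc.comp continuous_fst).rpow_const fun p => Or.inl (hpos _).ne'
  · exact fun p => (Real.rpow_pos_of_pos (hpos _) _).ne'

lemma iSup_density_pos (hpos : ∀ x, 0 < π x) (hb : BddAbove (Set.range π)) (x : X) :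
    0 < ⨆ z, π z := (hpos x).trans_le (le_ciSup hb x)

lemma one_le_driftW (hpos : ∀ x, 0 < π x) (hb : BddAbove (Set.range π)) (hτ : 0 < τ) (x : X) :
    1 ≤ driftW π τ x := by
  have hs := iSup_density_pos hpos hb x
  exact Real.one_le_rpow_of_pos_of_le_one_of_nonpos (div_pos (hpos x) hs)
    ((div_le_one hs).2 (le_ciSup hb x)) (by linarith)

lemma continuous_driftW [TopologicalSpace X] (hc : Continuous π) (hpos : ∀ x, 0 < π x)
    (hb : BddAbove (Set.range π)) : Continuous (driftW π τ) := by
  unfold driftW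
  exact (hc.div_const _).rpow_const fun x =>
    Or.inl (div_pos (hpos x) (iSup_density_pos hpos hb x)).ne'

/-- The sublevel sets of `W` are contained in superlevel sets of the density. -/
lemma exists_level_of_driftW_le (hpos : ∀ x, 0 < π x) (hb : BddAbove (Set.range π)) (hτ : 0 < τ)
    [Nonempty X] {R : ℝ} (hR : 1 < R) :
    ∃ p, 0 < p ∧ p < ⨆ z, π z ∧ ∀ x, driftW π τ x ≤ R → p ≤ π x := by
  have hs := iSup_density_pos hpos hb (Classical.arbitrary X)
  have hR0 : 0 < R := by linarith
  refine ⟨(⨆ z, π z) * R ^ (-(1 / τ)), by positivity, ?_, fun x hx => ?_⟩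
  · have : R ^ (-(1 / τ)) < 1 :=
      Real.rpow_lt_one_of_one_lt_of_neg hR (by simpa using hτ)
    nlinarith
  · have hq : 0 < π x / ⨆ z, π z := div_pos (hpos x) hs
    have h1 : R ^ (-(1 / τ)) ≤ driftW π τ x ^ (-(1 / τ)) :=
      Real.rpow_le_rpow_of_nonpos (Real.rpow_pos_of_pos hq _) hx (by simpa using hτ.le)
    rw [driftW, ← Real.rpow_mul hq.le, show -τ * -(1 / τ) = 1 by field_simp, Real.rpow_one,
      le_div_iff₀ hs] at h1
    linarith

end Basic

lemma integrable_of_abs_le {α : Type*} [MeasurableSpace α] {m : Measure α} [IsFiniteMeasure m]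
    {φ : α → ℝ} (hφ : Measurable φ) {C : ℝ} (hC : ∀ x, |φ x| ≤ C) : Integrable φ m :=
  Integrable.of_bound hφ.aestronglyMeasurable C (ae_of_all _ hC)

lemma abs_integral_le_of_abs_le {α : Type*} [MeasurableSpace α] {m : Measure α}
    [IsProbabilityMeasure m] {φ : α → ℝ} {C : ℝ} (hC : ∀ x, |φ x| ≤ C) : |∫ x, φ x ∂m| ≤ C := by
  simpa using norm_integral_le_of_norm_le_const (μ := m) (f := φ) (C := C) (ae_of_all _ hC)

section Step

variable {X : Type*} [TopologicalSpace X] [PolishSpace X] [MeasurableSpace X] [BorelSpace X]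
  {π : X → ℝ} {T υ τ : ℝ} {P : Kernel X X}

lemma measurable_acceptance (hc : Continuous π) (hpos : ∀ x, 0 < π x) :
    Measurable fun p : X × X => acceptance π T p.1 p.2 :=
  (continuous_acceptance hc hpos).measurable

lemma measurable_acceptance_right (hc : Continuous π) (hpos : ∀ x, 0 < π x) (x : X) :
    Measurable (acceptance π T x) :=
  (measurable_acceptance hc hpos).comp measurable_prodMk_left

lemma lintegral_samplerStep (hc : Continuous π) (hpos : ∀ x, 0 < π x) (θ : Measure X) (x : X)
    {g : X → ENNReal} (hg : Measurable g) :
    ∫⁻ z, g z ∂(samplerStep P π T υ θ x) = ENNReal.ofReal (1 - υ) * ∫⁻ z, g z ∂(P x) +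
      ENNReal.ofReal υ * (∫⁻ y, ENNReal.ofReal (acceptance π T x y) * g y ∂θ +
        (∫⁻ y, ENNReal.ofReal (1 - acceptance π T x y) ∂θ) * g x) := by
  have hα := (measurable_acceptance_right (T := T) hc hpos x).ennreal_ofReal
  simp only [samplerStep, interactionStep, lintegral_add_measure, lintegral_smul_measure,
    lintegral_dirac' _ hg, lintegral_withDensity_eq_lintegral_mul _ hα hg, smul_eq_mul,
    Pi.mul_apply]

/-- The drift condition for one step of the sampler, with a constant that depends on `θ` only
through `θ(W)`. -/
lemma lintegral_driftW_samplerStep_le (hc : Continuous π) (hpos : ∀ x, 0 < π x)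
    (hb : BddAbove (Set.range π)) (θ : Measure X)
    [IsProbabilityMeasure θ] (x : X) {D : ENNReal}
    (hD : ∫⁻ z, ENNReal.ofReal (driftW π τ z) ∂(P x) ≤ D) :
    ∫⁻ z, ENNReal.ofReal (driftW π τ z) ∂(samplerStep P π T υ θ x) ≤
      ENNReal.ofReal (1 - υ) * D + ENNReal.ofReal υ *
        (∫⁻ y, ENNReal.ofReal (driftW π τ y) ∂θ + ENNReal.ofReal (driftW π τ x)) := by
  rw [lintegral_samplerStep hc hpos θ x (continuous_driftW hc hpos hb).measurable.ennreal_ofReal]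
  gcongr
  · rename_i y
    refine mul_le_of_le_one_left zero_le ?_
    simpa using acceptance_le_one (π := π) (T := T) x y
  · refine mul_le_of_le_one_left zero_le ?_
    refine (lintegral_mono (g := fun _ => 1) fun y => ?_).trans (by simp)
    simpa using acceptance_nonneg hpos x y

lemma measurable_samplerStep (hc : Continuous π) (hpos : ∀ x, 0 < π x) {A : Type*}
    [MeasurableSpace A] (Θ : Kernel A X) [IsMarkovKernel Θ] {x : A → X} (hx : Measurable x) :
    Measurable fun a => samplerStep P π T υ (Θ a) (x a) := by
  refine Measure.measurable_of_measurable_coe _ fun s hs => ?_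
  have hg : Measurable (s.indicator (1 : X → ENNReal)) := measurable_one.indicator hs
  have key : ∀ a, samplerStep P π T υ (Θ a) (x a) s = _ := fun a => by
    rw [← lintegral_indicator_one hs, lintegral_samplerStep hc hpos (Θ a) (x a) hg]
  simp_rw [key]
  have hα : Measurable fun p : A × X => acceptance π T (x p.1) p.2 :=
    (measurable_acceptance hc hpos).comp ((hx.comp measurable_fst).prodMk measurable_snd)
  refine Measurable.add (Measurable.const_mul ?_ _) (Measurable.const_mul (Measurable.add ?_
    (Measurable.mul ?_ (hg.comp hx))) _)
  · exact (hg.lintegral_kernel (κ := P)).comp hx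
  · exact Measurable.lintegral_kernel_prod_right (κ := Θ)
      (hα.ennreal_ofReal.mul (hg.comp measurable_snd))
  · exact Measurable.lintegral_kernel_prod_right (κ := Θ)
      (measurable_const.sub hα).ennreal_ofReal

/-- One step of the sampler, as a transition kernel driven by a random auxiliary measure. -/
noncomputable def samplerKernel (P : Kernel X X) (T υ : ℝ) (hc : Continuous π)
    (hpos : ∀ x, 0 < π x) {A : Type*}
    [MeasurableSpace A] (Θ : Kernel A X) [IsMarkovKernel Θ] {x : A → X} (hx : Measurable x) :
    Kernel A X :=
  ⟨fun a => samplerStep P π T υ (Θ a) (x a), measurable_samplerStep hc hpos Θ hx⟩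

variable [IsMarkovKernel P]

lemma isProbabilityMeasure_samplerStep (hc : Continuous π) (hpos : ∀ x, 0 < π x)
    (hυ : υ ∈ Set.Ioo (0 : ℝ) 1) (θ : Measure X) [IsProbabilityMeasure θ] (x : X) :
    IsProbabilityMeasure (samplerStep P π T υ θ x) := by
  have hα := measurable_acceptance_right (T := T) hc hpos x
  constructor
  rw [← lintegral_one, lintegral_samplerStep hc hpos θ x measurable_const]
  simp only [mul_one, lintegral_one, measure_univ]
  rw [← lintegral_add_left hα.ennreal_ofReal]
  have : ∀ y, ENNReal.ofReal (acceptance π T x y) +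
      ENNReal.ofReal (1 - acceptance π T x y) = 1 := by
    intro y
    rw [← ENNReal.ofReal_add (acceptance_nonneg hpos x y)
      (by linarith [acceptance_le_one (π := π) (T := T) x y])]
    simp
  simp only [this, lintegral_one, measure_univ, mul_one]
  rw [← ENNReal.ofReal_add (by linarith [hυ.2]) hυ.1.le]
  simp

lemma integral_samplerStep (hc : Continuous π) (hpos : ∀ x, 0 < π x)
    (hυ : υ ∈ Set.Ioo (0 : ℝ) 1) (θ : Measure X) [IsProbabilityMeasure θ] (x : X)
    {φ : X → ℝ} (hφ : Measurable φ) {C : ℝ} (hC : ∀ x, |φ x| ≤ C) :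
    ∫ z, φ z ∂(samplerStep P π T υ θ x) = (1 - υ) * ∫ z, φ z ∂(P x) +
      υ * (φ x + ∫ y, acceptance π T x y * (φ y - φ x) ∂θ) := by
  have hα := measurable_acceptance_right (T := T) hc hpos x
  have hα1 : ∀ y, 0 ≤ 1 - acceptance π T x y := fun y => by
    linarith [acceptance_le_one (π := π) (T := T) x y]
  have hαint : Integrable (acceptance π T x) θ :=
    integrable_of_abs_le hα (abs_acceptance_le_one hpos x)
  have hαφ : Integrable (fun y => acceptance π T x y * φ y) θ := by
    refine integrable_of_abs_le (hα.mul hφ) (C := C) fun y => ?_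
    rw [abs_mul]
    exact (mul_le_of_le_one_left (abs_nonneg _) (abs_acceptance_le_one hpos x y)).trans (hC y)
  have hfin : ∫⁻ y, ENNReal.ofReal (1 - acceptance π T x y) ∂θ ≠ ⊤ := by
    refine ((lintegral_mono (g := fun _ => 1) fun y => ?_).trans_lt (by simp)).ne
    simpa using acceptance_nonneg hpos x y
  have hwd : IsFiniteMeasure (θ.withDensity fun y => ENNReal.ofReal (acceptance π T x y)) :=
    isFiniteMeasure_withDensity_ofReal hαint.2
  have hi : ∀ (m : Measure X) [IsFiniteMeasure m], Integrable φ m := fun m _ =>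
    integrable_of_abs_le hφ hC
  have hsm : ∀ (c : ENNReal) (m : Measure X) [IsFiniteMeasure m], c ≠ ⊤ → Integrable φ (c • m) :=
    fun c m _ h => (hi m).smul_measure h
  have h1 : Integrable φ (interactionStep π T θ x) :=
    (hi _).add_measure (hsm _ _ hfin)
  rw [samplerStep, integral_add_measure (hsm _ _ ENNReal.ofReal_ne_top)
    (h1.smul_measure ENNReal.ofReal_ne_top), integral_smul_measure, integral_smul_measure,
    interactionStep, integral_add_measure (hi _) (hsm _ _ hfin), integral_smul_measure,
    integral_dirac' _ _ hφ.stronglyMeasurable,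
    integral_withDensity_eq_integral_toReal_smul hα.ennreal_ofReal (by simp),
    ← integral_eq_lintegral_of_nonneg_ae (ae_of_all _ hα1)
      (measurable_const.sub hα).aestronglyMeasurable]
  simp only [smul_eq_mul, ENNReal.toReal_ofReal (acceptance_nonneg hpos x _),
    ENNReal.toReal_ofReal hυ.1.le, ENNReal.toReal_ofReal (sub_nonneg.2 hυ.2.le), mul_sub]
  rw [integral_sub (integrable_const _) hαint, integral_sub hαφ (hαint.mul_const _),
    integral_mul_const]
  simp only [integral_const, probReal_univ, smul_eq_mul]
  ring

lemma isMarkovKernel_samplerKernel (hc : Continuous π) (hpos : ∀ x, 0 < π x)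
    (hυ : υ ∈ Set.Ioo (0 : ℝ) 1) {A : Type*}
    [MeasurableSpace A] (Θ : Kernel A X) [IsMarkovKernel Θ] {x : A → X} (hx : Measurable x) :
    IsMarkovKernel (samplerKernel P T υ hc hpos Θ hx) :=
  ⟨fun a => isProbabilityMeasure_samplerStep hc hpos hυ (Θ a) (x a)⟩

/-- The action of one step of the sampler on functions. -/
noncomputable def stepOp (P : Kernel X X) (π : X → ℝ) (T υ : ℝ) (θ : Measure X) (φ : X → ℝ)
    (x : X) : ℝ :=
  ∫ z, φ z ∂(samplerStep P π T υ θ x)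

lemma abs_stepOp_le (hc : Continuous π) (hpos : ∀ x, 0 < π x)
    (hυ : υ ∈ Set.Ioo (0 : ℝ) 1) (θ : Measure X) [IsProbabilityMeasure θ]
    {φ : X → ℝ} {C : ℝ} (hC : ∀ x, |φ x| ≤ C) (x : X) : |stepOp P π T υ θ φ x| ≤ C := by
  have := isProbabilityMeasure_samplerStep (P := P) (T := T) hc hpos hυ θ x
  exact abs_integral_le_of_abs_le hC

lemma abs_stepOp_iterate_le (hc : Continuous π) (hpos : ∀ x, 0 < π x)
    (hυ : υ ∈ Set.Ioo (0 : ℝ) 1) (θ : Measure X) [IsProbabilityMeasure θ]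
    {φ : X → ℝ} {C : ℝ} (hC : ∀ x, |φ x| ≤ C) (N : ℕ) (x : X) :
    |(stepOp P π T υ θ)^[N] φ x| ≤ C := by
  induction N generalizing x with
  | zero => exact hC x
  | succ N ih =>
    rw [Function.iterate_succ_apply']
    exact abs_stepOp_le hc hpos hυ θ ih x

lemma measurable_stepOp_prod (hc : Continuous π) (hpos : ∀ x, 0 < π x)
    (hυ : υ ∈ Set.Ioo (0 : ℝ) 1) {A : Type*} [MeasurableSpace A] (Θ : Kernel A X)
    [IsMarkovKernel Θ] {φ : A → X → ℝ} (hφ : Measurable fun p : A × X => φ p.1 p.2) :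
    Measurable fun p : A × X => stepOp P π T υ (Θ p.1) (φ p.1) p.2 := by
  have := isMarkovKernel_samplerKernel (P := P) (T := T) (π := π) hc hpos hυ
    (Θ.comap Prod.fst measurable_fst) (measurable_snd : Measurable (Prod.snd : A × X → X))
  have hm : StronglyMeasurable fun q : (A × X) × X => φ q.1.1 q.2 :=
    (hφ.comp ((measurable_fst.comp measurable_fst).prodMk measurable_snd)).stronglyMeasurable
  exact (hm.integral_kernel_prod_right' (κ := samplerKernel P T υ hc hpos
    (Θ.comap Prod.fst measurable_fst)
    (measurable_snd : Measurable (Prod.snd : A × X → X)))).measurable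

lemma measurable_stepOp_iterate_prod (hc : Continuous π) (hpos : ∀ x, 0 < π x)
    (hυ : υ ∈ Set.Ioo (0 : ℝ) 1) {A : Type*} [MeasurableSpace A] (Θ : Kernel A X)
    [IsMarkovKernel Θ] {φ : X → ℝ} (hφ : Measurable φ) (N : ℕ) :
    Measurable fun p : A × X => (stepOp P π T υ (Θ p.1))^[N] φ p.2 := by
  induction N with
  | zero => exact hφ.comp measurable_snd
  | succ N ih =>
    simp only [Function.iterate_succ_apply']
    exact measurable_stepOp_prod hc hpos hυ Θ (φ := fun a => (stepOp P π T υ (Θ a))^[N] φ) ih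

lemma measurable_stepOp_iterate (hc : Continuous π) (hpos : ∀ x, 0 < π x)
    (hυ : υ ∈ Set.Ioo (0 : ℝ) 1) (θ : Measure X) [IsProbabilityMeasure θ]
    {φ : X → ℝ} (hφ : Measurable φ) (N : ℕ) :
    Measurable ((stepOp P π T υ θ)^[N] φ) :=
  (measurable_stepOp_iterate_prod (P := P) (T := T) hc hpos hυ (Kernel.const Unit θ) hφ N).comp
    (measurable_prodMk_left (x := ()))

end Step

section Contraction

/-- Two probability measures with a common part of mass `ε` integrate a function of controlled
oscillation to nearby values. -/
lemma abs_integral_sub_integral_le {X : Type*} [MeasurableSpace X] {m₁ m₂ ν : Measure X}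
    [IsProbabilityMeasure m₁] [IsProbabilityMeasure m₂] [IsFiniteMeasure ν] (h₁ : ν ≤ m₁)
    (h₂ : ν ≤ m₂) {W : X → ℝ} (hW0 : ∀ x, 0 ≤ W x) (hW₁ : Integrable W m₁)
    (hW₂ : Integrable W m₂) {φ : X → ℝ} (hφ : Measurable φ) {C : ℝ} (hC : ∀ x, |φ x| ≤ C)
    {c β : ℝ} (hc : 0 ≤ c) (hβ : 0 ≤ β)
    (hosc : ∀ u v, |φ u - φ v| ≤ c * (2 + β * (W u + W v))) :
    |∫ x, φ x ∂m₁ - ∫ x, φ x ∂m₂| ≤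
      c * (2 * (1 - ν.real Set.univ) + β * (∫ x, W x ∂m₁ + ∫ x, W x ∂m₂)) := by
  obtain ⟨x₀⟩ : Nonempty X := nonempty_of_isProbabilityMeasure m₁
  have : Nonempty X := ⟨x₀⟩
  have hbdd : BddAbove (Set.range fun u => φ u - c * (1 + β * W u)) := by
    refine ⟨C, ?_⟩
    rintro _ ⟨u, rfl⟩
    have := (abs_le.1 (hC u)).2
    have : 0 ≤ c * (1 + β * W u) := mul_nonneg hc (by nlinarith [mul_nonneg hβ (hW0 u)])
    linarith
  set a := ⨆ u, (φ u - c * (1 + β * W u)) with ha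
  have hup : ∀ u, φ u - a ≤ c * (1 + β * W u) := fun u => by
    have := le_ciSup hbdd u
    linarith
  have hlo : ∀ v, a - φ v ≤ c * (1 + β * W v) := fun v => by
    have : a ≤ φ v + c * (1 + β * W v) := ciSup_le fun u => by
      have := (abs_le.1 (hosc u v)).2
      linarith
    linarith
  have hdec : ∀ (m : Measure X) [IsProbabilityMeasure m], ν ≤ m → Integrable W m →
      |∫ x, φ x ∂m - ∫ x, φ x ∂ν - a * (1 - ν.real Set.univ)| ≤
        c * ((1 - ν.real Set.univ) + β * ∫ x, W x ∂m) := by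
    intro m _ hm hWm
    set q := m - ν with hq
    have hsum : q + ν = m := Measure.sub_add_cancel_of_le hm
    have hqm : q ≤ m := Measure.sub_le
    have : IsFiniteMeasure q := isFiniteMeasure_of_le m hqm
    have hmass : q.real Set.univ = 1 - ν.real Set.univ := by
      have : m.real Set.univ = q.real Set.univ + ν.real Set.univ := by
        rw [← hsum, measureReal_add_apply]
      rw [probReal_univ] at this
      linarith
    have hWq : Integrable W q := hWm.mono_measure hqm
    have hint : ∫ x, φ x ∂m = ∫ x, φ x ∂q + ∫ x, φ x ∂ν := by
      rw [← hsum, integral_add_measure (integrable_of_abs_le hφ hC) (integrable_of_abs_le hφ hC)]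
    have heq : ∫ x, φ x ∂m - ∫ x, φ x ∂ν - a * (1 - ν.real Set.univ) = ∫ x, (φ x - a) ∂q := by
      rw [integral_sub (integrable_of_abs_le hφ hC) (integrable_const _), hint, integral_const,
        hmass, smul_eq_mul]
      ring
    have hbound : ∫ x, c * (1 + β * W x) ∂q = c * ((1 - ν.real Set.univ) + β * ∫ x, W x ∂q) := by
      rw [integral_const_mul, integral_add (integrable_const _) (hWq.const_mul _),
        integral_const_mul, integral_const, hmass]
      simp
    have hmono : ∫ x, W x ∂q ≤ ∫ x, W x ∂m :=
      integral_mono_measure hqm (ae_of_all _ hW0) hWm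
    rw [heq]
    calc |∫ x, (φ x - a) ∂q| ≤ ∫ x, c * (1 + β * W x) ∂q := by
          refine norm_integral_le_of_norm_le (f := fun x => φ x - a)
            (((integrable_const _).add (hWq.const_mul _)).const_mul _)
            (ae_of_all _ fun x => abs_le.2 ⟨?_, hup x⟩)
          linarith [hlo x]
      _ = c * ((1 - ν.real Set.univ) + β * ∫ x, W x ∂q) := hbound
      _ ≤ _ := by gcongr
  have e1 := abs_le.1 (hdec m₁ h₁ hW₁)
  have e2 := abs_le.1 (hdec m₂ h₂ hW₂)
  rw [abs_le]
  constructor <;> nlinarith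

/-- Existence of the constants in the contraction estimate: a drift condition with constants `L`
and `B`, and a minorization on every sublevel set. -/
lemma exists_contraction_constants {L B : ℝ} (hL : L < 1) (hB : 0 ≤ B)
    {ε : ℝ → ℝ} (hε : ∀ R, 1 < R → 0 < ε R) (hε1 : ∀ R, 1 < R → ε R ≤ 1) :
    ∃ ρ β R : ℝ, 0 ≤ ρ ∧ ρ < 1 ∧ 0 < β ∧ 1 < R ∧ ∀ s, 0 ≤ s →
      (R ≤ s → 2 + β * (L * s + 2 * B) ≤ ρ * (2 + β * s)) ∧
      2 * (1 - ε R) + β * (L * s + 2 * B) ≤ ρ * (2 + β * s) := by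
  have h1L : 0 < 1 - L := by linarith
  set R := 4 * (B + 1) / (1 - L) + 2 with hR
  have hR1 : 1 < R := by
    have : 0 ≤ 4 * (B + 1) / (1 - L) := by positivity
    linarith
  have he := hε R hR1
  have he1 := hε1 R hR1
  set e := ε R
  set β := e / (2 * (B + 1)) with hβ
  have hβ0 : 0 < β := by positivity
  have hβe : β * (2 * (B + 1)) = e := by rw [hβ]; field_simp
  have hβ1 : β < 1 := by nlinarith
  refine ⟨max ((1 + L) / 2) (1 - β), β, R, le_max_of_le_right (by linarith), max_lt (by linarith)
    (by linarith), hβ0, hR1, fun s hs => ?_⟩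
  set ρ := max ((1 + L) / 2) (1 - β)
  have h1 : (1 + L) / 2 ≤ ρ := le_max_left _ _
  have h2 : 1 - β ≤ ρ := le_max_right _ _
  have hmul : β * s * ((1 + L) / 2) ≤ β * s * ρ := by gcongr
  refine ⟨fun hRs => ?_, ?_⟩
  · have hs4 : 4 * (B + 1) ≤ s * (1 - L) := by
      have : 4 * (B + 1) / (1 - L) ≤ s := by linarith
      rwa [div_le_iff₀ h1L] at this
    have := mul_le_mul_of_nonneg_left hs4 hβ0.le
    nlinarith
  · have : 0 ≤ β * s * (1 - L) := by positivity
    nlinarith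

variable {X : Type*} [TopologicalSpace X] [MeasurableSpace X]
  {μ : Measure X} {π : X → ℝ} {T υ τ : ℝ} {P : Kernel X X}

/-- Minorization of one step of the sampler by one step of `P`. -/
lemma exists_minorization (hI1 : TargetCondition μ π) (hτ : 0 < τ) [IsMarkovKernel P]
    [Nonempty X]
    (hsmall : ∀ p : ℝ, 0 < p → p < ⨆ z, π z → IsOneSmall P {x | p ≤ π x})
    (hυ : υ ∈ Set.Ioo (0 : ℝ) 1) {R : ℝ} (hR : 1 < R) :
    ∃ ν : Measure X, IsFiniteMeasure ν ∧ 0 < ν.real Set.univ ∧ ν.real Set.univ ≤ 1 ∧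
      ∀ (θ : Measure X) (x : X), driftW π τ x ≤ R → ν ≤ samplerStep P π T υ θ x := by
  obtain ⟨p, hp0, hp1, hp⟩ := exists_level_of_driftW_le hI1.pos hI1.bounded hτ hR
  obtain ⟨ν, hν0, hν⟩ := hsmall p hp0 hp1
  obtain ⟨x₁, hx₁⟩ := exists_lt_of_lt_ciSup hp1
  have hle : ∀ x, p ≤ π x → ν ≤ P x := fun x hx => Measure.le_intro fun s hs _ => hν x hx s hs
  have : IsFiniteMeasure ν := isFiniteMeasure_of_le _ (hle x₁ hx₁.le)
  have hν1 : ν.real Set.univ ≤ 1 := by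
    have h := ENNReal.toReal_mono (by simp) (hle x₁ hx₁.le Set.univ)
    simpa [Measure.real] using h
  have hνpos : 0 < ν.real Set.univ :=
    ENNReal.toReal_pos (by simpa using hν0) (measure_ne_top _ _)
  have hr : (ENNReal.ofReal (1 - υ) • ν).real Set.univ = (1 - υ) * ν.real Set.univ := by
    rw [measureReal_ennreal_smul_apply, ENNReal.toReal_ofReal (by linarith [hυ.2])]
  refine ⟨ENNReal.ofReal (1 - υ) • ν, Measure.smul_finite _ ENNReal.ofReal_ne_top, ?_, ?_, ?_⟩
  · rw [hr]
    exact mul_pos (by linarith [hυ.2]) hνpos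
  · rw [hr]
    nlinarith [hυ.1]
  · intro θ x hx
    refine le_trans ?_ (Measure.le_add_right le_rfl)
    exact Measure.le_intro fun s _ _ => by
      simp only [Measure.smul_apply, smul_eq_mul]
      gcongr
      exact hle x (hp x hx)

variable [PolishSpace X] [BorelSpace X]

/-- A real form of the drift condition for one step of the sampler. -/
lemma integrable_driftW_samplerStep (hI1 : TargetCondition μ π) (hτ : 0 < τ) {lam b : ℝ}
    (hlam : 0 < lam) (hb : 0 ≤ b)
    (hdrift : ∀ x, ∫⁻ y, ENNReal.ofReal (driftW π τ y) ∂(P x) ≤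
      ENNReal.ofReal (lam * driftW π τ x + b)) (hυ : υ ∈ Set.Ioo (0 : ℝ) 1)
    (θ : Measure X) [IsProbabilityMeasure θ] {D : ℝ} (hD0 : 0 ≤ D)
    (hD : ∫⁻ y, ENNReal.ofReal (driftW π τ y) ∂θ ≤ ENNReal.ofReal D) (x : X) :
    Integrable (driftW π τ) (samplerStep P π T υ θ x) ∧
      ∫ y, driftW π τ y ∂(samplerStep P π T υ θ x) ≤
        ((1 - υ) * lam + υ) * driftW π τ x + ((1 - υ) * b + υ * D) := by
  have hW1 := one_le_driftW hI1.pos hI1.bounded hτ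
  have hW0 : ∀ x, 0 ≤ driftW π τ x := fun x => zero_le_one.trans (hW1 x)
  have hυ1 : 0 ≤ 1 - υ := by linarith [hυ.2]
  have hm := (continuous_driftW (τ := τ) hI1.continuous hI1.pos hI1.bounded).measurable
  have hnn : 0 ≤ lam * driftW π τ x + b := by have := hW0 x; positivity
  have key : ∫⁻ y, ENNReal.ofReal (driftW π τ y) ∂(samplerStep P π T υ θ x) ≤
      ENNReal.ofReal (((1 - υ) * lam + υ) * driftW π τ x + ((1 - υ) * b + υ * D)) := by
    refine (lintegral_driftW_samplerStep_le hI1.continuous hI1.pos hI1.bounded θ x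
      (hdrift x)).trans ?_
    calc _ ≤ ENNReal.ofReal (1 - υ) * ENNReal.ofReal (lam * driftW π τ x + b) +
          ENNReal.ofReal υ * (ENNReal.ofReal D + ENNReal.ofReal (driftW π τ x)) := by gcongr
      _ = _ := by
        rw [← ENNReal.ofReal_add hD0 (hW0 x), ← ENNReal.ofReal_mul hυ1,
          ← ENNReal.ofReal_mul hυ.1.le, ← ENNReal.ofReal_add (mul_nonneg hυ1 hnn)
            (mul_nonneg hυ.1.le (add_nonneg hD0 (hW0 x)))]
        congr 1
        ring
  have hint : Integrable (driftW π τ) (samplerStep P π T υ θ x) :=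
    (lintegral_ofReal_ne_top_iff_integrable hm.aestronglyMeasurable (ae_of_all _ hW0)).1
      (key.trans_lt ENNReal.ofReal_lt_top).ne
  refine ⟨hint, ?_⟩
  rw [← ENNReal.ofReal_le_ofReal_iff, ofReal_integral_eq_lintegral_ofReal hint (ae_of_all _ hW0)]
  · exact key
  · have := hW0 x
    have := hυ.1.le
    positivity

/-- Uniform geometric contraction of the sampler, over all auxiliary measures `θ` with `θ(W) ≤ D`. -/
lemma exists_geometric_contraction [IsMarkovKernel P] [Nonempty X] (hI1 : TargetCondition μ π)
    (hτ : 0 < τ) (hυ : υ ∈ Set.Ioo (0 : ℝ) 1)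
    (hsmall : ∀ p : ℝ, 0 < p → p < ⨆ z, π z → IsOneSmall P {x | p ≤ π x})
    {lam b : ℝ} (hlam : 0 < lam) (hlam1 : lam < 1) (hb : 0 ≤ b)
    (hdrift : ∀ x, ∫⁻ y, ENNReal.ofReal (driftW π τ y) ∂(P x) ≤
      ENNReal.ofReal (lam * driftW π τ x + b)) {D : ℝ} (hD0 : 0 ≤ D) :
    ∃ ρ β : ℝ, 0 ≤ ρ ∧ ρ < 1 ∧ 0 < β ∧ ∀ (θ : Measure X) [IsProbabilityMeasure θ],
      ∫⁻ y, ENNReal.ofReal (driftW π τ y) ∂θ ≤ ENNReal.ofReal D →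
      ∀ (f : X → ℝ) (C : ℝ), Measurable f → (∀ x, |f x| ≤ C) → ∀ (N : ℕ) (x y : X),
        |(stepOp P π T υ θ)^[N] f x - (stepOp P π T υ θ)^[N] f y| ≤
          C * ρ ^ N * (2 + β * (driftW π τ x + driftW π τ y)) := by
  have hW1 := one_le_driftW hI1.pos hI1.bounded hτ
  have hW0 : ∀ x, 0 ≤ driftW π τ x := fun x => zero_le_one.trans (hW1 x)
  have hυ1 : 0 < 1 - υ := by linarith [hυ.2]
  have hmin : ∀ R : ℝ, ∃ ν : Measure X, 1 < R → IsFiniteMeasure ν ∧ 0 < ν.real Set.univ ∧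
      ν.real Set.univ ≤ 1 ∧
      ∀ (θ : Measure X) (x : X), driftW π τ x ≤ R → ν ≤ samplerStep P π T υ θ x := fun R => by
    by_cases hR : 1 < R
    · obtain ⟨ν, h⟩ := exists_minorization (T := T) hI1 hτ hsmall hυ hR
      exact ⟨ν, fun _ => h⟩
    · exact ⟨0, fun h => absurd h hR⟩
  choose ν hν using hmin
  obtain ⟨ρ, β, R, hρ0, hρ1, hβ, hR, hmain⟩ := exists_contraction_constants
    (L := (1 - υ) * lam + υ) (B := (1 - υ) * b + υ * D) (by nlinarith)
    (by have := hυ.1.le; positivity) (fun R hR => (hν R hR).2.1) (fun R hR => (hν R hR).2.2.1)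
  refine ⟨ρ, β, hρ0, hρ1, hβ, fun θ _ hθ f C hf hC N => ?_⟩
  obtain ⟨x₀⟩ := ‹Nonempty X›
  have hC0 : 0 ≤ C := (abs_nonneg _).trans (hC x₀)
  induction N with
  | zero =>
    intro x y
    simp only [Function.iterate_zero, id_eq, pow_zero, mul_one]
    have h1 := abs_sub (f x) (f y)
    have : 0 ≤ C * (β * (driftW π τ x + driftW π τ y)) := by
      have := hW0 x
      have := hW0 y
      positivity
    linarith [hC x, hC y]
  | succ N ih =>
    intro x y
    rw [Function.iterate_succ_apply', pow_succ]
    have hpr := isProbabilityMeasure_samplerStep (P := P) (T := T) hI1.continuous hI1.pos hυ θ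
    obtain ⟨hix, hx⟩ := integrable_driftW_samplerStep (T := T) hI1 hτ hlam hb hdrift hυ θ hD0 hθ x
    obtain ⟨hiy, hy⟩ := integrable_driftW_samplerStep (T := T) hI1 hτ hlam hb hdrift hυ θ hD0 hθ y
    have hgm := measurable_stepOp_iterate (P := P) (T := T) hI1.continuous hI1.pos hυ θ hf N
    have hgC := abs_stepOp_iterate_le (P := P) (T := T) hI1.continuous hI1.pos hυ θ hC N
    have hs : 0 ≤ driftW π τ x + driftW π τ y := add_nonneg (hW0 x) (hW0 y)
    obtain ⟨hlarge, hall⟩ := hmain _ hs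
    have hcN : 0 ≤ C * ρ ^ N := by positivity
    have hWsum : ∫ z, driftW π τ z ∂(samplerStep P π T υ θ x) +
        ∫ z, driftW π τ z ∂(samplerStep P π T υ θ y) ≤
        ((1 - υ) * lam + υ) * (driftW π τ x + driftW π τ y) + 2 * ((1 - υ) * b + υ * D) := by
      linarith
    have hWβ := mul_le_mul_of_nonneg_left hWsum hβ.le
    rcases le_or_gt R (driftW π τ x + driftW π τ y) with hRs | hRs
    · have h0 := abs_integral_sub_integral_le (ν := 0) (Measure.zero_le _) (Measure.zero_le _)
        hW0 hix hiy hgm hgC hcN hβ.le ih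
      refine h0.trans ?_
      rw [← mul_assoc C, mul_assoc (C * ρ ^ N)]
      refine mul_le_mul_of_nonneg_left ?_ hcN
      simp only [measureReal_zero, Pi.zero_apply, sub_zero, mul_one]
      linarith [hlarge hRs]
    · obtain ⟨hfin, -, -, hle⟩ := hν R hR
      have h0 := abs_integral_sub_integral_le (hle θ x (by linarith [hW0 y]))
        (hle θ y (by linarith [hW0 x])) hW0 hix hiy hgm hgC hcN hβ.le ih
      refine h0.trans ?_
      rw [← mul_assoc C, mul_assoc (C * ρ ^ N)]
      refine mul_le_mul_of_nonneg_left ?_ hcN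
      linarith

end Contraction

lemma integral_bind_kernel {A B : Type*} [MeasurableSpace A] [MeasurableSpace B] {η : Measure A}
    [IsFiniteMeasure η] {κ : Kernel A B} [IsMarkovKernel κ] {φ : B → ℝ} (hφ : Measurable φ)
    {C : ℝ} (hC : ∀ x, |φ x| ≤ C) : ∫ x, φ x ∂(η.bind κ) = ∫ a, ∫ x, φ x ∂(κ a) ∂η := by
  have h : Integrable φ (η.bind κ) := integrable_of_abs_le hφ hC
  rw [Measure.comp_eq_comp_const_apply] at h ⊢
  rw [Kernel.integral_comp h, Kernel.const_apply]

section WeakConvergence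

variable {X : Type*} [TopologicalSpace X] [PolishSpace X] [MeasurableSpace X] [BorelSpace X]

/-- Lower approximation of the mass of an open set by integrals along an approximating sequence of
the complement. -/
lemma tendsto_one_sub_integral_apprSeq {F : Set X} (hF : IsClosed F) (m : ProbabilityMeasure X) :
    Tendsto (fun k => 1 - ∫ x, (hF.apprSeq k x : ℝ) ∂(m : Measure X)) atTop
      (𝓝 (m Fᶜ : ℝ)) := by
  have h := HasOuterApproxClosed.tendsto_lintegral_apprSeq hF (m : Measure X)
  have h2 := ((ENNReal.tendsto_toReal (measure_ne_top _ _)).comp h).const_sub 1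
  simp only [Function.comp_def, toReal_lintegral_coe_eq_integral] at h2
  convert h2 using 2
  exact probReal_compl_eq_one_sub (μ := (m : Measure X)) hF.measurableSet

lemma one_sub_integral_apprSeq_le {F : Set X} (hF : IsClosed F) (m : ProbabilityMeasure X)
    (k : ℕ) : 1 - ∫ x, (hF.apprSeq k x : ℝ) ∂(m : Measure X) ≤ (m Fᶜ : ℝ) := by
  have h := ENNReal.toReal_mono (BoundedContinuousFunction.lintegral_lt_top_of_nnreal
    (m : Measure X) (hF.apprSeq k)).ne
    (HasOuterApproxClosed.measure_le_lintegral hF (μ := (m : Measure X)) k)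
  rw [toReal_lintegral_coe_eq_integral] at h
  have h2 := probReal_compl_eq_one_sub (μ := (m : Measure X)) hF.measurableSet
  have h3 : (m Fᶜ : ℝ) = (m : Measure X).real Fᶜ := rfl
  rw [h3, h2]
  exact sub_le_sub_left h 1

/-- If the integrals of each bounded continuous function converge almost surely, then the random
measures converge weakly almost surely. -/
lemma ae_tendsto_probabilityMeasure {Ω : Type*} [MeasurableSpace Ω] {Pr : Measure Ω}
    {θ : Ω → ℕ → ProbabilityMeasure X} {θ' : ProbabilityMeasure X}
    (h : ∀ f : X →ᵇ ℝ, ∀ᵐ ω ∂Pr, Tendsto (fun n => ∫ x, f x ∂(θ ω n : Measure X)) atTop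
      (𝓝 (∫ x, f x ∂(θ' : Measure X)))) :
    ∀ᵐ ω ∂Pr, Tendsto (θ ω) atTop (𝓝 θ') := by
  classical
  have hcount := TopologicalSpace.countable_countableBasis X
  have : Countable (TopologicalSpace.countableBasis X) := hcount.to_subtype
  have hop : ∀ S : Finset (TopologicalSpace.countableBasis X), IsOpen (⋃ s ∈ S, (s : Set X)) :=
    fun S => isOpen_biUnion fun s _ => TopologicalSpace.isOpen_of_mem_countableBasis s.2
  have hcl := fun S => (hop S).isClosed_compl
  have hall : ∀ᵐ ω ∂Pr, ∀ (S : Finset (TopologicalSpace.countableBasis X)) (k : ℕ),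
      Tendsto (fun n => ∫ x, ((hcl S).apprSeq k x : ℝ) ∂(θ ω n : Measure X)) atTop
        (𝓝 (∫ x, ((hcl S).apprSeq k x : ℝ) ∂(θ' : Measure X))) := by
    rw [ae_all_iff]
    intro S
    rw [ae_all_iff]
    intro k
    exact h ⟨⟨fun x => ((hcl S).apprSeq k x : ℝ),
      NNReal.continuous_coe.comp ((hcl S).apprSeq k).continuous⟩,
      ((hcl S).apprSeq k).map_bounded'⟩
  filter_upwards [hall] with ω hω
  refine tendsto_of_forall_isOpen_le_liminf fun G hG => ?_
  refine (le_liminf_iff (isCoboundedUnder_ge_of_le (x := 1) _ (by simp))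
    (by isBoundedDefault)).2 fun r hr => ?_
  obtain ⟨S, hS, hrS, hSG⟩ := ProbabilityMeasure.exists_lt_measure_biUnion_of_isOpen
    (S := TopologicalSpace.countableBasis X) θ'
    (fun u hu x hx => by
      obtain ⟨v, hv, hxv, hvu⟩ :=
        (TopologicalSpace.isBasis_countableBasis X).exists_subset_of_mem_open hx hu
      exact ⟨v, hv, (TopologicalSpace.isOpen_of_mem_countableBasis hv).mem_nhds hxv, hvu⟩) hG hr
  let S' : Finset (TopologicalSpace.countableBasis X) := S.subtype _
  have hS' : (⋃ s ∈ S', (s : Set X)) = ⋃ s ∈ S, s := by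
    ext x
    simp only [S', Set.mem_iUnion, Finset.mem_subtype, Subtype.exists, exists_prop]
    exact ⟨fun ⟨a, _, ha, hx⟩ => ⟨a, ha, hx⟩, fun ⟨a, ha, hx⟩ => ⟨a, hS a ha, ha, hx⟩⟩
  rw [← hS'] at hrS hSG
  have hlim := tendsto_one_sub_integral_apprSeq (hcl S') θ'
  rw [compl_compl] at hlim
  obtain ⟨k, hk⟩ := (hlim.eventually (lt_mem_nhds (NNReal.coe_lt_coe.2 hrS))).exists
  filter_upwards [((hω S' k).const_sub 1).eventually (lt_mem_nhds hk)] with n hn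
  have hle := one_sub_integral_apprSeq_le (hcl S') (θ ω n) k
  rw [compl_compl] at hle
  exact (NNReal.coe_lt_coe.1 (hn.trans_le hle)).trans_le (ProbabilityMeasure.apply_mono _ hSG)

end WeakConvergence

section Dual

variable {X : Type*} [TopologicalSpace X] [PolishSpace X] [MeasurableSpace X] [BorelSpace X]
  {μ : Measure X} {π : X → ℝ} {T υ τ : ℝ} {P : Kernel X X} [IsMarkovKernel P]

/-- The law after one step of the sampler started from `η`, with auxiliary measure `θ`. -/
noncomputable def dualStep (P : Kernel X X) [IsMarkovKernel P] (T : ℝ) (hc : Continuous π)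
    (hpos : ∀ x, 0 < π x) (hυ : υ ∈ Set.Ioo (0 : ℝ) 1) (θ η : ProbabilityMeasure X) :
    ProbabilityMeasure X :=
  ⟨(η : Measure X).bind (samplerKernel P T υ hc hpos (Kernel.const X (θ : Measure X))
    measurable_id), by
      have := isMarkovKernel_samplerKernel (P := P) (T := T) hc hpos hυ
        (Kernel.const X (θ : Measure X)) measurable_id
      infer_instance⟩

lemma integral_dualStep (hc : Continuous π) (hpos : ∀ x, 0 < π x) (hυ : υ ∈ Set.Ioo (0 : ℝ) 1)
    (θ η : ProbabilityMeasure X) {φ : X → ℝ} (hφ : Measurable φ) {C : ℝ} (hC : ∀ x, |φ x| ≤ C) :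
    ∫ x, φ x ∂(dualStep P T hc hpos hυ θ η : Measure X) =
      ∫ x, stepOp P π T υ θ φ x ∂(η : Measure X) := by
  have := isMarkovKernel_samplerKernel (P := P) (T := T) hc hpos hυ
    (Kernel.const X (θ : Measure X)) measurable_id
  exact integral_bind_kernel hφ hC

lemma integral_stepOp_iterate (hc : Continuous π) (hpos : ∀ x, 0 < π x)
    (hυ : υ ∈ Set.Ioo (0 : ℝ) 1) (θ η : ProbabilityMeasure X) {φ : X → ℝ} (hφ : Measurable φ)
    {C : ℝ} (hC : ∀ x, |φ x| ≤ C) (N : ℕ) :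
    ∫ x, (stepOp P π T υ θ)^[N] φ x ∂(η : Measure X) =
      ∫ x, φ x ∂(((dualStep P T hc hpos hυ θ)^[N] η : ProbabilityMeasure X) : Measure X) := by
  induction N generalizing η with
  | zero => rfl
  | succ N ih =>
    rw [Function.iterate_succ_apply', Function.iterate_succ_apply, ← ih,
      integral_dualStep hc hpos hυ θ η (measurable_stepOp_iterate hc hpos hυ θ hφ N)
        (abs_stepOp_iterate_le hc hpos hυ θ hC N)]

lemma integrable_acceptance_mul (hc : Continuous π) (hpos : ∀ x, 0 < π x) (m : Measure (X × X))
    [IsFiniteMeasure m] {φ : X → ℝ} (hφ : Measurable φ) {C : ℝ} (hC : ∀ x, |φ x| ≤ C) :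
    Integrable (fun p : X × X => acceptance π T p.1 p.2 * (φ p.2 - φ p.1)) m := by
  refine integrable_of_abs_le ((measurable_acceptance hc hpos).mul
    ((hφ.comp measurable_snd).sub (hφ.comp measurable_fst))) (C := C + C) fun p => ?_
  rw [abs_mul]
  refine (mul_le_of_le_one_left (abs_nonneg _) (abs_acceptance_le_one hpos _ _)).trans ?_
  exact (abs_sub _ _).trans (add_le_add (hC _) (hC _))

lemma integral_stepOp (hc : Continuous π) (hpos : ∀ x, 0 < π x)
    (hυ : υ ∈ Set.Ioo (0 : ℝ) 1) (θ η : Measure X) [IsProbabilityMeasure θ]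
    [IsProbabilityMeasure η] {φ : X → ℝ} (hφ : Measurable φ) {C : ℝ} (hC : ∀ x, |φ x| ≤ C) :
    ∫ x, stepOp P π T υ θ φ x ∂η = (1 - υ) * ∫ x, ∫ y, φ y ∂(P x) ∂η +
      υ * (∫ x, φ x ∂η + ∫ p, acceptance π T p.1 p.2 * (φ p.2 - φ p.1) ∂(η.prod θ)) := by
  have hI := integrable_acceptance_mul (T := T) hc hpos (η.prod θ) hφ hC
  have hφi : Integrable φ η := integrable_of_abs_le hφ hC
  have hPi : Integrable (fun x => ∫ y, φ y ∂(P x)) η :=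
    integrable_of_abs_le hφ.stronglyMeasurable.integral_kernel.measurable
      fun x => abs_integral_le_of_abs_le hC
  simp only [stepOp, integral_samplerStep hc hpos hυ θ _ hφ hC]
  have hJ : Integrable (fun x => ∫ y, acceptance π T x y * (φ y - φ x) ∂θ) η :=
    hI.integral_prod_left
  have hK : Integrable (fun x => φ x + ∫ y, acceptance π T x y * (φ y - φ x) ∂θ) η := hφi.add hJ
  rw [integral_add (hPi.const_mul _) (hK.const_mul _), integral_const_mul, integral_const_mul,
    integral_add hφi hJ, integral_prod _ hI]

lemma tendsto_dualStep (hc : Continuous π) (hpos : ∀ x, 0 < π x) (hυ : υ ∈ Set.Ioo (0 : ℝ) 1)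
    (hP : IsFeller P) {ι : Type*} {l : Filter ι} {θs ηs : ι → ProbabilityMeasure X}
    {θ η : ProbabilityMeasure X} (hθ : Tendsto θs l (𝓝 θ)) (hη : Tendsto ηs l (𝓝 η)) :
    Tendsto (fun i => dualStep P T hc hpos hυ (θs i) (ηs i)) l
      (𝓝 (dualStep P T hc hpos hυ θ η)) := by
  rw [ProbabilityMeasure.tendsto_iff_forall_integral_tendsto]
  intro f
  have hC : ∀ x, |f x| ≤ ‖f‖ := f.norm_coe_le_norm
  have hm : Measurable f := f.continuous.measurable
  simp only [integral_dualStep hc hpos hυ _ _ hm hC, integral_stepOp hc hpos hυ _ _ hm hC]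
  have hprod : Tendsto (fun i => (ηs i).prod (θs i)) l (𝓝 (η.prod θ)) :=
    (ProbabilityMeasure.continuous_prod.tendsto (η, θ)).comp (hη.prodMk_nhds hθ)
  let Pf : X →ᵇ ℝ := BoundedContinuousFunction.ofNormedAddCommGroup
    (fun x => ∫ y, f y ∂(P x)) (hP f) ‖f‖ fun x => abs_integral_le_of_abs_le hC
  let h : X × X →ᵇ ℝ := BoundedContinuousFunction.ofNormedAddCommGroup
    (fun p => acceptance π T p.1 p.2 * (f p.2 - f p.1))
    ((continuous_acceptance hc hpos).mul
      ((f.continuous.comp continuous_snd).sub (f.continuous.comp continuous_fst))) (‖f‖ + ‖f‖)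
    fun p => by
      rw [Real.norm_eq_abs, abs_mul]
      refine (mul_le_of_le_one_left (abs_nonneg _) (abs_acceptance_le_one hpos _ _)).trans ?_
      exact (abs_sub _ _).trans (add_le_add (hC _) (hC _))
  have h1 := ProbabilityMeasure.tendsto_iff_forall_integral_tendsto.1 hη Pf
  have h2 := ProbabilityMeasure.tendsto_iff_forall_integral_tendsto.1 hη f
  have h3 := ProbabilityMeasure.tendsto_iff_forall_integral_tendsto.1 hprod h
  exact (h1.const_mul _).add ((h2.add h3).const_mul _)

lemma tendsto_stepOp_iterate (hc : Continuous π) (hpos : ∀ x, 0 < π x)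
    (hυ : υ ∈ Set.Ioo (0 : ℝ) 1) (hP : IsFeller P) {ι : Type*} {l : Filter ι}
    {θs : ι → ProbabilityMeasure X} {θ : ProbabilityMeasure X} (hθ : Tendsto θs l (𝓝 θ))
    (f : X →ᵇ ℝ) (N : ℕ) (x : X) :
    Tendsto (fun i => (stepOp P π T υ (θs i))^[N] f x) l
      (𝓝 ((stepOp P π T υ θ)^[N] f x)) := by
  have hC : ∀ x, |f x| ≤ ‖f‖ := f.norm_coe_le_norm
  have hm : Measurable f := f.continuous.measurable
  let δ : ProbabilityMeasure X := ⟨Measure.dirac x, inferInstance⟩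
  have hd : Tendsto (fun i => (dualStep P T hc hpos hυ (θs i))^[N] δ) l
      (𝓝 ((dualStep P T hc hpos hυ θ)^[N] δ)) := by
    induction N with
    | zero => exact tendsto_const_nhds
    | succ N ih =>
      simp only [Function.iterate_succ_apply']
      exact tendsto_dualStep hc hpos hυ hP hθ ih
  have key : ∀ m : ProbabilityMeasure X, (stepOp P π T υ m)^[N] f x =
      ∫ z, f z ∂(((dualStep P T hc hpos hυ m)^[N] δ : ProbabilityMeasure X) : Measure X) := by
    intro m
    rw [← integral_stepOp_iterate hc hpos hυ m δ hm hC]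
    exact (integral_dirac' _ _
      (measurable_stepOp_iterate hc hpos hυ m hm N).stronglyMeasurable).symm
  simp only [key]
  exact ProbabilityMeasure.tendsto_iff_forall_integral_tendsto.1 hd f

end Dual

section Invariance

lemma target_mul_acceptance_symm {X : Type*} {π : X → ℝ} {T : ℝ} (hpos : ∀ x, 0 < π x) (x y : X) :
    π x * (π y ^ (1 / T) * acceptance π T x y) = π y * (π x ^ (1 / T) * acceptance π T y x) := by
  have aux : ∀ u v, π u * (π v ^ (1 / T) * acceptance π T u v) =
      π u ^ (1 / T) * π v ^ (1 / T) * min (π u ^ (1 - 1 / T)) (π v ^ (1 - 1 / T)) := by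
    intro u v
    have hu : π u = π u ^ (1 / T) * π u ^ (1 - 1 / T) := by
      rw [← Real.rpow_add (hpos u)]
      simp
    have hp : 0 < π u ^ (1 - 1 / T) := Real.rpow_pos_of_pos (hpos u) _
    have hmin : π u ^ (1 - 1 / T) * acceptance π T u v =
        min (π u ^ (1 - 1 / T)) (π v ^ (1 - 1 / T)) := by
      rw [acceptance, mul_min_of_nonneg _ _ hp.le, mul_one, mul_div_cancel₀ _ hp.ne']
    calc π u * (π v ^ (1 / T) * acceptance π T u v)
        = (π u ^ (1 / T) * π u ^ (1 - 1 / T)) * (π v ^ (1 / T) * acceptance π T u v) := by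
          rw [← hu]
      _ = π u ^ (1 / T) * π v ^ (1 / T) * (π u ^ (1 - 1 / T) * acceptance π T u v) := by ring
      _ = _ := by rw [hmin]
  rw [aux, aux, min_comm]
  ring

variable {X : Type*} [TopologicalSpace X] [MeasurableSpace X]
  {μ : Measure X} {π : X → ℝ} {T υ τ : ℝ} {P : Kernel X X}

lemma isProbabilityMeasure_target (hI1 : TargetCondition μ π) :
    IsProbabilityMeasure (target μ π) := by
  constructor
  rw [target, withDensity_apply _ MeasurableSet.univ, Measure.restrict_univ, hI1.density]

variable [BorelSpace X]

lemma sFinite_of_targetCondition (hI1 : TargetCondition μ π) : SFinite μ := by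
  have := isProbabilityMeasure_target hI1
  have h : (target μ π).withDensity (fun x => (ENNReal.ofReal (π x))⁻¹) = μ :=
    withDensity_inv_same hI1.continuous.measurable.ennreal_ofReal
      (ae_of_all _ fun x => by simpa using hI1.pos x) (ae_of_all _ fun x => by simp)
  rw [← h]
  infer_instance

lemma temperedMass_pos (hI1 : TargetCondition μ π) : 0 < temperedMass μ π T := by
  have hμ : μ ≠ 0 := by
    rintro rfl
    simpa using hI1.density
  have hm : Measurable fun x => ENNReal.ofReal (π x ^ (1 / T)) :=
    (hI1.continuous.measurable.pow_const _).ennreal_ofReal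
  rw [temperedMass, lintegral_pos_iff_support hm]
  have : Function.support (fun x => ENNReal.ofReal (π x ^ (1 / T))) = Set.univ := by
    ext x
    simpa using Real.rpow_pos_of_pos (hI1.pos x) _
  rw [this]
  exact Measure.measure_univ_pos.2 hμ

lemma isProbabilityMeasure_temperedTarget (hI1 : TargetCondition μ π)
    (hmass : temperedMass μ π T < ⊤) : IsProbabilityMeasure (temperedTarget μ π T) := by
  constructor
  rw [temperedTarget, Measure.smul_apply, withDensity_apply _ MeasurableSet.univ,
    Measure.restrict_univ, smul_eq_mul]
  exact ENNReal.inv_mul_cancel (temperedMass_pos hI1).ne' hmass.ne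

/-- Reversibility of the interaction step with respect to the target. -/
lemma integral_acceptance_mul_eq_zero (hI1 : TargetCondition μ π)
    (hmass : temperedMass μ π T < ⊤)
    (φ : X → ℝ) :
    ∫ p, acceptance π T p.1 p.2 * (φ p.2 - φ p.1)
      ∂((target μ π).prod (temperedTarget μ π T)) = 0 := by
  have := isProbabilityMeasure_target hI1
  have := isProbabilityMeasure_temperedTarget hI1 hmass
  have := sFinite_of_targetCondition hI1
  set d₁ : X → ENNReal := fun x => ENNReal.ofReal (π x)
  set d₂ : X → ENNReal := fun x => ENNReal.ofReal (π x ^ (1 / T))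
  have hd₁ : Measurable d₁ := hI1.continuous.measurable.ennreal_ofReal
  have hd₂ : Measurable d₂ := (hI1.continuous.measurable.pow_const _).ennreal_ofReal
  have hprod : (target μ π).prod (temperedTarget μ π T) = (temperedMass μ π T)⁻¹ •
      (μ.prod μ).withDensity fun p => d₁ p.1 * d₂ p.2 := by
    rw [temperedTarget, Measure.prod_smul_right, target, prod_withDensity hd₁ hd₂]
  rw [hprod, integral_smul_measure, smul_eq_zero]
  right
  rw [integral_withDensity_eq_integral_toReal_smul
    (f := fun p : X × X => d₁ p.1 * d₂ p.2)
    ((hd₁.comp measurable_fst).mul (hd₂.comp measurable_snd))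
    (ae_of_all _ fun p => ENNReal.mul_lt_top ENNReal.ofReal_lt_top ENNReal.ofReal_lt_top)]
  set H : X × X → ℝ := fun p =>
    (d₁ p.1 * d₂ p.2).toReal • (acceptance π T p.1 p.2 * (φ p.2 - φ p.1)) with hH
  have hanti : ∀ p : X × X, H p.swap = -H p := by
    rintro ⟨x, y⟩
    have hx : 0 ≤ π x ^ (1 / T) := Real.rpow_nonneg (hI1.pos x).le _
    have hy : 0 ≤ π y ^ (1 / T) := Real.rpow_nonneg (hI1.pos y).le _
    have := target_mul_acceptance_symm (T := T) hI1.pos x y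
    simp only [hH, d₁, d₂, Prod.swap, ENNReal.toReal_mul, ENNReal.toReal_ofReal (hI1.pos _).le,
      ENNReal.toReal_ofReal hx, ENNReal.toReal_ofReal hy, smul_eq_mul]
    linear_combination (φ y - φ x) * this
  have hswap := integral_prod_swap (μ := μ) (ν := μ) H
  simp only [hanti, integral_neg] at hswap
  linarith

lemma integral_stepOp_target [PolishSpace X] [IsMarkovKernel P] (hI1 : TargetCondition μ π)
    (hmass : temperedMass μ π T < ⊤) (hυ : υ ∈ Set.Ioo (0 : ℝ) 1)
    (hinv : Kernel.Invariant P (target μ π)) {φ : X → ℝ}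
    (hφ : Measurable φ) {C : ℝ} (hC : ∀ x, |φ x| ≤ C) (N : ℕ) :
    ∫ x, (stepOp P π T υ (temperedTarget μ π T))^[N] φ x ∂(target μ π) =
      ∫ x, φ x ∂(target μ π) := by
  have := isProbabilityMeasure_target hI1
  have := isProbabilityMeasure_temperedTarget hI1 hmass
  induction N with
  | zero => rfl
  | succ N ih =>
    have hm := measurable_stepOp_iterate (P := P) (T := T) hI1.continuous hI1.pos hυ
      (temperedTarget μ π T) hφ N
    have hb := abs_stepOp_iterate_le (P := P) (T := T) hI1.continuous hI1.pos hυ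
      (temperedTarget μ π T) hC N
    simp only [Function.iterate_succ_apply']
    rw [integral_stepOp hI1.continuous hI1.pos hυ _ _ hm hb,
      integral_acceptance_mul_eq_zero hI1 hmass, ← integral_bind_kernel hm hb, hinv, ih]
    ring

end Invariance

section Empirical

variable {X : Type*} [MeasurableSpace X]

lemma lintegral_empirical (y : ℕ → X) (n : ℕ) {g : X → ENNReal} (hg : Measurable g) :
    ∫⁻ x, g x ∂(empirical y n) =
      ((n : ENNReal) + 1)⁻¹ * ∑ k ∈ Finset.range (n + 1), g (y k) := by
  rw [empirical, lintegral_smul_measure, lintegral_finsetSum_measure]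
  simp only [lintegral_dirac' _ hg, smul_eq_mul]

instance isProbabilityMeasure_empirical (y : ℕ → X) (n : ℕ) :
    IsProbabilityMeasure (empirical y n) := by
  constructor
  rw [← lintegral_one, lintegral_empirical y n measurable_const]
  simp only [Finset.sum_const, Finset.card_range, nsmul_eq_mul, mul_one]
  push_cast
  exact ENNReal.inv_mul_cancel (by simp) (by simp)

lemma integral_empirical (y : ℕ → X) (n : ℕ) {h : X → ℝ} (hh : Measurable h) :
    ∫ x, h x ∂(empirical y n) = ((n : ℝ) + 1)⁻¹ * ∑ k ∈ Finset.range (n + 1), h (y k) := by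
  have hd : ∀ k, Integrable h (Measure.dirac (y k)) := fun k =>
    (integrable_dirac' hh.stronglyMeasurable enorm_lt_top)
  rw [empirical, integral_smul_measure, integral_finsetSum_measure fun k _ => hd k]
  simp only [integral_dirac' _ _ hh.stronglyMeasurable, ENNReal.toReal_inv, smul_eq_mul]
  congr 2

lemma empirical_congr {y y' : ℕ → X} {n : ℕ} (h : ∀ k ≤ n, y k = y' k) :
    empirical y n = empirical y' n := by
  unfold empirical
  congr 1
  exact Finset.sum_congr rfl fun k hk => by rw [h k (by simpa [Nat.lt_succ_iff] using hk)]

lemma measurable_empirical (n : ℕ) : Measurable fun y : ℕ → X => empirical y n := by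
  refine Measure.measurable_of_measurable_coe _ fun s hs => ?_
  have hg : Measurable (s.indicator (1 : X → ENNReal)) := measurable_one.indicator hs
  have key : ∀ y : ℕ → X, empirical y n s = _ := fun y => by
    rw [← lintegral_indicator_one hs, lintegral_empirical y n hg]
  simp_rw [key]
  exact (Finset.measurable_sum _ fun k _ => hg.comp (measurable_pi_apply k)).const_mul _

/-- The empirical distribution of the first `n + 1` terms of a sequence, as a kernel. -/
noncomputable def empiricalKernel (X : Type*) [MeasurableSpace X] (n : ℕ) : Kernel (ℕ → X) X :=
  ⟨fun y => empirical y n, measurable_empirical n⟩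

instance isMarkovKernel_empiricalKernel (n : ℕ) : IsMarkovKernel (empiricalKernel X n) :=
  ⟨fun y => isProbabilityMeasure_empirical y n⟩

lemma measurable_lintegral_empirical {Ω : Type*} [MeasurableSpace Ω] {Ys : ℕ → Ω → X}
    (hY : ∀ k, Measurable (Ys k)) (n : ℕ) {g : X → ENNReal} (hg : Measurable g) :
    Measurable fun ω => ∫⁻ x, g x ∂(empirical (fun k => Ys k ω) n) :=
  (hg.lintegral_kernel (κ := empiricalKernel X n)).comp (measurable_pi_iff.2 hY)

lemma abs_integral_empirical_sub_le (y : ℕ → X) (n j : ℕ) {h : X → ℝ} (hh : Measurable h) {D : ℝ}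
    (hD : ∀ x, |h x| ≤ D) :
    |∫ x, h x ∂(empirical y (n + j)) - ∫ x, h x ∂(empirical y n)| ≤ 2 * D * j / (n + 1) := by
  have hD0 : 0 ≤ D := (abs_nonneg _).trans (hD (y 0))
  induction j with
  | zero => simp
  | succ j ih =>
    have hn : (0 : ℝ) < (n : ℝ) + 1 := by positivity
    have hj : (0 : ℝ) < (n : ℝ) + j + 1 := by positivity
    have hstep : ∫ x, h x ∂(empirical y (n + (j + 1))) - ∫ x, h x ∂(empirical y (n + j)) =
        (h (y (n + j + 1)) - ∫ x, h x ∂(empirical y (n + j))) / (n + j + 2) := by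
      rw [← add_assoc, integral_empirical y _ hh, integral_empirical y _ hh,
        Finset.sum_range_succ _ (n + j + 1)]
      push_cast
      field_simp
      ring
    have hbound : |∫ x, h x ∂(empirical y (n + (j + 1))) - ∫ x, h x ∂(empirical y (n + j))| ≤
        2 * D / (n + 1) := by
      rw [hstep, abs_div, abs_of_pos (show (0 : ℝ) < (n : ℝ) + j + 2 by positivity)]
      have h1 : |h (y (n + j + 1)) - ∫ x, h x ∂(empirical y (n + j))| ≤ 2 * D := by
        have := abs_sub (h (y (n + j + 1))) (∫ x, h x ∂(empirical y (n + j)))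
        linarith [hD (y (n + j + 1)), abs_integral_le_of_abs_le (m := empirical y (n + j)) hD]
      have hj0 : (0 : ℝ) ≤ j := Nat.cast_nonneg j
      exact div_le_div₀ (by positivity) h1 hn (by linarith)
    calc _ ≤ _ := abs_sub_le _ (∫ x, h x ∂(empirical y (n + j))) _
      _ ≤ 2 * D / (n + 1) + 2 * D * j / (n + 1) := add_le_add hbound ih
      _ = _ := by push_cast; ring

end Empirical

section History

variable {X : Type*} [MeasurableSpace X] {π : X → ℝ} {T υ : ℝ} {P : Kernel X X}
  {Ω : Type*} {Xs Ys : ℕ → Ω → X}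

/-- The state of the sampler at time `m`, together with the auxiliary process stopped at time
`m`. -/
def history (Xs Ys : ℕ → Ω → X) (m : ℕ) (ω : Ω) : X × (ℕ → X) :=
  (Xs m ω, fun k => Ys (min k m) ω)

lemma empirical_history {n m : ℕ} (h : n ≤ m) (ω : Ω) :
    empirical (history Xs Ys m ω).2 n = empirical (fun k => Ys k ω) n :=
  empirical_congr fun k hk => by simp [history, min_eq_left (hk.trans h)]

lemma measurable_history_of_le [MeasurableSpace Ω] {m : ℕ} (hX : Measurable (Xs m))
    (hY : ∀ k ≤ m, Measurable (Ys k)) : Measurable (history Xs Ys m) :=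
  hX.prodMk (measurable_pi_iff.2 fun k => hY _ (min_le_right k m))

variable {mΩ : MeasurableSpace Ω} {Pr : Measure Ω} {ℱ : Filtration ℕ mΩ}

lemma measurable_history_filtration (hX : IsSampler Pr ℱ P π T υ Xs Ys) (m : ℕ) :
    Measurable[ℱ m] (history Xs Ys m) :=
  @measurable_history_of_le _ _ _ _ _ (ℱ m) m (hX.adapted_X m) fun k hk =>
    (hX.adapted_Y k).mono (ℱ.mono hk) le_rfl

lemma measurable_history (hX : IsSampler Pr ℱ P π T υ Xs Ys) (m : ℕ) :
    Measurable (history Xs Ys m) :=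
  (measurable_history_filtration hX m).mono (ℱ.le m) le_rfl

lemma measurable_state (hX : IsSampler Pr ℱ P π T υ Xs Ys) (m : ℕ) : Measurable (Xs m) :=
  (hX.adapted_X m).mono (ℱ.le m) le_rfl

lemma measurable_auxiliary (hX : IsSampler Pr ℱ P π T υ Xs Ys) (m : ℕ) : Measurable (Ys m) :=
  (hX.adapted_Y m).mono (ℱ.le m) le_rfl

end History

section Sampler

variable {X : Type*} [TopologicalSpace X] [PolishSpace X] [MeasurableSpace X] [BorelSpace X]
  {μ : Measure X} {π : X → ℝ} {T υ τ : ℝ} {P : Kernel X X} {Ω : Type*} {Xs Ys : ℕ → Ω → X}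

/-- The transition kernel of the sampler at time `m`, from histories. -/
noncomputable def historyKernel (P : Kernel X X) (T υ : ℝ) (hc : Continuous π)
    (hpos : ∀ x, 0 < π x) (m : ℕ) : Kernel (X × (ℕ → X)) X :=
  samplerKernel P T υ hc hpos ((empiricalKernel X m).comap Prod.snd measurable_snd)
    measurable_fst

lemma historyKernel_apply (hc : Continuous π) (hpos : ∀ x, 0 < π x) (m : ℕ) (ω : Ω) :
    historyKernel P T υ hc hpos m (history Xs Ys m ω) =
      samplerStep P π T υ (empirical (fun k => Ys k ω) m) (Xs m ω) := by
  rw [← empirical_history (Xs := Xs) le_rfl ω]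
  rfl

variable [IsMarkovKernel P] {mΩ : MeasurableSpace Ω} {Pr : Measure Ω} [IsProbabilityMeasure Pr]
  {ℱ : Filtration ℕ mΩ}

/-- Measurability of the iterates with auxiliary measure frozen at a random empirical
distribution. -/
lemma measurable_stepOp_iterate_empirical (hc : Continuous π) (hpos : ∀ x, 0 < π x)
    (hυ : υ ∈ Set.Ioo (0 : ℝ) 1) [MeasurableSpace Ω] (hY : ∀ k, Measurable (Ys k)) {Z : Ω → X}
    (hZ : Measurable Z) {f : X → ℝ} (hf : Measurable f) (n N : ℕ) :
    Measurable fun ω => (stepOp P π T υ (empirical (fun k => Ys k ω) n))^[N] f (Z ω) := by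
  have hp : Measurable fun ω => ((fun k => Ys k ω, Z ω) : (ℕ → X) × X) :=
    (measurable_pi_iff.2 hY).prodMk hZ
  have h := (measurable_stepOp_iterate_prod (P := P) (T := T) hc hpos hυ
    (empiricalKernel X n) hf N).comp hp
  exact h

/-- Changing the auxiliary measure between two nearby empirical distributions moves one step of the
sampler little. -/
lemma abs_stepOp_empirical_sub_le (hc : Continuous π) (hpos : ∀ x, 0 < π x)
    (hυ : υ ∈ Set.Ioo (0 : ℝ) 1) (y : ℕ → X) (n j : ℕ) {φ : X → ℝ} (hφ : Measurable φ) {C : ℝ}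
    (hC : ∀ x, |φ x| ≤ C) (x : X) :
    |stepOp P π T υ (empirical y (n + j)) φ x - stepOp P π T υ (empirical y n) φ x| ≤
      4 * C * j / (n + 1) := by
  have hm : Measurable fun z => acceptance π T x z * (φ z - φ x) :=
    (measurable_acceptance_right hc hpos x).mul (hφ.sub_const _)
  have hb : ∀ z, |acceptance π T x z * (φ z - φ x)| ≤ 2 * C := fun z => by
    rw [abs_mul]
    refine (mul_le_of_le_one_left (abs_nonneg _) (abs_acceptance_le_one hpos _ _)).trans ?_
    linarith [abs_sub (φ z) (φ x), hC z, hC x]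
  have h := abs_integral_empirical_sub_le y n j hm hb
  rw [stepOp, stepOp, integral_samplerStep hc hpos hυ _ x hφ hC,
    integral_samplerStep hc hpos hυ _ x hφ hC]
  have heq : ∀ a b c d : ℝ, (a + υ * (b + c)) - (a + υ * (b + d)) = υ * (c - d) := by
    intros
    ring
  rw [heq, abs_mul, abs_of_pos hυ.1]
  refine (mul_le_of_le_one_left (abs_nonneg _) hυ.2.le).trans (h.trans_eq ?_)
  ring

lemma isMarkovKernel_historyKernel (hc : Continuous π) (hpos : ∀ x, 0 < π x)
    (hυ : υ ∈ Set.Ioo (0 : ℝ) 1) (m : ℕ) : IsMarkovKernel (historyKernel P T υ hc hpos m) :=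
  isMarkovKernel_samplerKernel hc hpos hυ _ _

/-- The joint law of the history at time `m` and of the next state. -/
lemma map_history_next (hc : Continuous π) (hpos : ∀ x, 0 < π x) (hυ : υ ∈ Set.Ioo (0 : ℝ) 1)
    (hX : IsSampler Pr ℱ P π T υ Xs Ys) (m : ℕ) :
    Pr.map (fun ω => (history Xs Ys m ω, Xs (m + 1) ω)) =
      (Pr.map (history Xs Ys m)) ⊗ₘ historyKernel P T υ hc hpos m := by
  have := isMarkovKernel_historyKernel (P := P) (T := T) hc hpos hυ m
  have hH := measurable_history hX m
  have hN := measurable_state hX (m + 1)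
  have := Measure.isProbabilityMeasure_map (μ := Pr) hH.aemeasurable
  have := Measure.isProbabilityMeasure_map (μ := Pr) (hH.prodMk hN).aemeasurable
  refine Measure.ext_prod fun {A B} hA hB => ?_
  rw [Measure.map_apply (hH.prodMk hN) (hA.prod hB), Measure.compProd_apply_prod hA hB,
    setLIntegral_map hA (Kernel.measurable_coe _ hB) hH]
  set s := history Xs Ys m ⁻¹' A
  have hs : MeasurableSet[ℱ m] s := measurable_history_filtration hX m hA
  have hsm : MeasurableSet s := ℱ.le m _ hs
  have hBm : MeasurableSet (Xs (m + 1) ⁻¹' B) := hN hB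
  have hf : Measurable (B.indicator (1 : X → ℝ)) := measurable_one.indicator hB
  have hf1 : ∀ x, |B.indicator (1 : X → ℝ) x| ≤ 1 := fun x => by
    by_cases hx : x ∈ B <;> simp [hx]
  have htr := hX.transition m _ hf ⟨1, hf1⟩
  have hset := setIntegral_condExp (ℱ.le m) (integrable_of_abs_le (m := Pr) (hf.comp hN)
    (fun ω => hf1 _)) hs
  have hlhs : ∫ ω in s, (B.indicator (1 : X → ℝ) ∘ Xs (m + 1)) ω ∂Pr =
      Pr.real (s ∩ Xs (m + 1) ⁻¹' B) := by
    have : B.indicator (1 : X → ℝ) ∘ Xs (m + 1) = (Xs (m + 1) ⁻¹' B).indicator 1 := rfl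
    rw [this, integral_indicator_one hBm, measureReal_restrict_apply hBm, Set.inter_comm]
  have hrhs : ∫ ω in s, (Pr[B.indicator (1 : X → ℝ) ∘ Xs (m + 1) | ℱ m]) ω ∂Pr =
      ∫ ω in s, (historyKernel P T υ hc hpos m (history Xs Ys m ω) B).toReal ∂Pr := by
    refine setIntegral_congr_ae hsm ?_
    filter_upwards [htr] with ω hω _
    rw [historyKernel_apply]
    refine hω.trans ?_
    rw [integral_indicator_one hB]
    rfl
  have hmeas : Measurable fun ω => historyKernel P T υ hc hpos m (history Xs Ys m ω) B :=
    (Kernel.measurable_coe _ hB).comp hH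
  have hfin : ∫⁻ ω in s, historyKernel P T υ hc hpos m (history Xs Ys m ω) B ∂Pr ≠ ⊤ :=
    ((lintegral_mono (g := fun _ => 1) fun ω => prob_le_one).trans_lt (by simp)).ne
  have hreal : Pr.real (s ∩ Xs (m + 1) ⁻¹' B) =
      (∫⁻ ω in s, historyKernel P T υ hc hpos m (history Xs Ys m ω) B ∂Pr).toReal := by
    rw [← hlhs, ← hset, hrhs, integral_toReal hmeas.aemeasurable
      (ae_of_all _ fun ω => measure_lt_top _ _)]
  exact (ENNReal.toReal_eq_toReal_iff' (measure_ne_top _ _) hfin).1 hreal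

lemma integral_history_next (hc : Continuous π) (hpos : ∀ x, 0 < π x)
    (hυ : υ ∈ Set.Ioo (0 : ℝ) 1) (hX : IsSampler Pr ℱ P π T υ Xs Ys) (m : ℕ)
    {G : (ℕ → X) → X → ℝ} (hG : Measurable fun p : (ℕ → X) × X => G p.1 p.2) {C : ℝ}
    (hC : ∀ y x, |G y x| ≤ C) :
    ∫ ω, G (history Xs Ys m ω).2 (Xs (m + 1) ω) ∂Pr =
      ∫ ω, stepOp P π T υ (empirical (fun k => Ys k ω) m) (G (history Xs Ys m ω).2)
        (Xs m ω) ∂Pr := by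
  have := isMarkovKernel_historyKernel (P := P) (T := T) hc hpos hυ m
  have hH := measurable_history hX m
  have hN := measurable_state hX (m + 1)
  have := Measure.isProbabilityMeasure_map (μ := Pr) hH.aemeasurable
  have hF : Measurable fun p : (X × (ℕ → X)) × X => G p.1.2 p.2 :=
    hG.comp ((measurable_snd.comp measurable_fst).prodMk measurable_snd)
  have h1 : ∫ ω, G (history Xs Ys m ω).2 (Xs (m + 1) ω) ∂Pr =
      ∫ p, G p.1.2 p.2 ∂(Pr.map fun ω => (history Xs Ys m ω, Xs (m + 1) ω)) :=
    (integral_map (hH.prodMk hN).aemeasurable hF.aestronglyMeasurable).symm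
  rw [h1, map_history_next hc hpos hυ hX m,
    Measure.integral_compProd (integrable_of_abs_le hF fun p => hC _ _),
    integral_map hH.aemeasurable
      (hF.stronglyMeasurable.integral_kernel_prod_right'
        (κ := historyKernel P T υ hc hpos m)).aestronglyMeasurable]
  simp only [historyKernel_apply]
  rfl

lemma lintegral_next (hc : Continuous π) (hpos : ∀ x, 0 < π x)
    (hυ : υ ∈ Set.Ioo (0 : ℝ) 1) (hX : IsSampler Pr ℱ P π T υ Xs Ys) (m : ℕ)
    {g : X → ENNReal} (hg : Measurable g) :
    ∫⁻ ω, g (Xs (m + 1) ω) ∂Pr =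
      ∫⁻ ω, ∫⁻ z, g z ∂(samplerStep P π T υ (empirical (fun k => Ys k ω) m) (Xs m ω)) ∂Pr := by
  have := isMarkovKernel_historyKernel (P := P) (T := T) hc hpos hυ m
  have hH := measurable_history hX m
  have hN := measurable_state hX (m + 1)
  have := Measure.isProbabilityMeasure_map (μ := Pr) hH.aemeasurable
  have hF : Measurable fun p : (X × (ℕ → X)) × X => g p.2 := hg.comp measurable_snd
  have h1 : ∫⁻ ω, g (Xs (m + 1) ω) ∂Pr =
      ∫⁻ p, g p.2 ∂(Pr.map fun ω => (history Xs Ys m ω, Xs (m + 1) ω)) :=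
    (lintegral_map hF (hH.prodMk hN)).symm
  rw [h1, map_history_next hc hpos hυ hX m, Measure.lintegral_compProd hF,
    lintegral_map (hg.lintegral_kernel (κ := historyKernel P T υ hc hpos m)) hH]
  simp only [historyKernel_apply]

/-- The `W`-moments of the sampler are bounded. -/
lemma exists_moment_bound (hI1 : TargetCondition μ π) (hτ : 0 < τ) {lam b : ℝ}
    (hlam : 0 < lam) (hlam1 : lam < 1) (hb : 0 ≤ b)
    (hdrift : ∀ x, ∫⁻ y, ENNReal.ofReal (driftW π τ y) ∂(P x) ≤
      ENNReal.ofReal (lam * driftW π τ x + b)) (hυ : υ ∈ Set.Ioo (0 : ℝ) 1)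
    (hX : IsSampler Pr ℱ P π T υ Xs Ys)
    (hY : ⨆ n, ∫⁻ ω, ENNReal.ofReal (driftW π τ (Ys n ω)) ∂Pr < ⊤)
    (hX0 : ∫⁻ ω, ENNReal.ofReal (driftW π τ (Xs 0 ω)) ∂Pr < ⊤) :
    ∃ M : ℝ, 0 ≤ M ∧ ∀ n, ∫⁻ ω, ENNReal.ofReal (driftW π τ (Xs n ω)) ∂Pr ≤ ENNReal.ofReal M := by
  have hW0 : ∀ x, 0 ≤ driftW π τ x := fun x =>
    zero_le_one.trans (one_le_driftW hI1.pos hI1.bounded hτ x)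
  have hWm := (continuous_driftW (τ := τ) hI1.continuous hI1.pos hI1.bounded).measurable
  have hg : Measurable fun x => ENNReal.ofReal (driftW π τ x) := hWm.ennreal_ofReal
  have hυ1 : 0 < 1 - υ := by linarith [hυ.2]
  set S := (⨆ n, ∫⁻ ω, ENNReal.ofReal (driftW π τ (Ys n ω)) ∂Pr).toReal with hS
  have hS0 : 0 ≤ S := ENNReal.toReal_nonneg
  have hYS : ∀ n, ∫⁻ ω, ENNReal.ofReal (driftW π τ (Ys n ω)) ∂Pr ≤ ENNReal.ofReal S := fun n => by
    rw [hS, ENNReal.ofReal_toReal hY.ne]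
    exact le_iSup (fun n => ∫⁻ ω, ENNReal.ofReal (driftW π τ (Ys n ω)) ∂Pr) n
  have hemp : ∀ n, ∫⁻ ω, ∫⁻ z, ENNReal.ofReal (driftW π τ z)
      ∂(empirical (fun k => Ys k ω) n) ∂Pr ≤ ENNReal.ofReal S := fun n => by
    simp only [lintegral_empirical _ n hg]
    have hk : ∀ k, Measurable fun ω => ENNReal.ofReal (driftW π τ (Ys k ω)) := fun k =>
      hg.comp (measurable_auxiliary hX k)
    rw [lintegral_const_mul _ (Finset.measurable_sum _ fun k _ => hk k),
      lintegral_finsetSum _ fun k _ => hk k]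
    calc _ ≤ ((n : ENNReal) + 1)⁻¹ * ∑ _k ∈ Finset.range (n + 1), ENNReal.ofReal S := by
          gcongr
          exact hYS _
      _ = ((n : ENNReal) + 1)⁻¹ * ((n : ENNReal) + 1) * ENNReal.ofReal S := by
          simp [mul_assoc]
      _ = ENNReal.ofReal S := by
          rw [ENNReal.inv_mul_cancel (by simp) (by simp), one_mul]
  set L := (1 - υ) * lam + υ with hL
  have hL1 : 0 < 1 - L := by nlinarith
  set B := (1 - υ) * b + υ * S with hB
  have hB0 : 0 ≤ B := by have := hυ.1.le; positivity
  set M₀ := (∫⁻ ω, ENNReal.ofReal (driftW π τ (Xs 0 ω)) ∂Pr).toReal with hM₀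
  refine ⟨max M₀ (B / (1 - L)), le_max_of_le_left ENNReal.toReal_nonneg, fun n => ?_⟩
  set M := max M₀ (B / (1 - L)) with hM
  have hM0 : 0 ≤ M := le_max_of_le_left ENNReal.toReal_nonneg
  induction n with
  | zero =>
    rw [← ENNReal.ofReal_toReal hX0.ne]
    exact ENNReal.ofReal_le_ofReal (le_max_left _ _)
  | succ n ih =>
    rw [lintegral_next hI1.continuous hI1.pos hυ hX n hg]
    have hXn : Measurable fun ω => ENNReal.ofReal (driftW π τ (Xs n ω)) :=
      hg.comp (measurable_state hX n)
    have hDn : Measurable fun ω => ENNReal.ofReal (lam * driftW π τ (Xs n ω) + b) :=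
      (((hWm.comp (measurable_state hX n)).const_mul lam).add_const b).ennreal_ofReal
    have hlin : ∫⁻ ω, ENNReal.ofReal (lam * driftW π τ (Xs n ω) + b) ∂Pr ≤
        ENNReal.ofReal (lam * M + b) := by
      have : ∀ ω, ENNReal.ofReal (lam * driftW π τ (Xs n ω) + b) =
          ENNReal.ofReal lam * ENNReal.ofReal (driftW π τ (Xs n ω)) + ENNReal.ofReal b := fun ω => by
        rw [ENNReal.ofReal_add (mul_nonneg hlam.le (hW0 _)) hb, ENNReal.ofReal_mul hlam.le]
      simp only [this]
      rw [lintegral_add_right _ measurable_const, lintegral_const_mul _ hXn, lintegral_const,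
        measure_univ, mul_one, ENNReal.ofReal_add (by positivity) hb, ENNReal.ofReal_mul hlam.le]
      gcongr
    calc _ ≤ ∫⁻ ω, (ENNReal.ofReal (1 - υ) * ENNReal.ofReal (lam * driftW π τ (Xs n ω) + b) +
          ENNReal.ofReal υ * (∫⁻ z, ENNReal.ofReal (driftW π τ z)
            ∂(empirical (fun k => Ys k ω) n) + ENNReal.ofReal (driftW π τ (Xs n ω)))) ∂Pr :=
        lintegral_mono fun ω => lintegral_driftW_samplerStep_le hI1.continuous hI1.pos
          hI1.bounded _ _ (hdrift _)
      _ = ENNReal.ofReal (1 - υ) * ∫⁻ ω, ENNReal.ofReal (lam * driftW π τ (Xs n ω) + b) ∂Pr +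
          ENNReal.ofReal υ * (∫⁻ ω, ∫⁻ z, ENNReal.ofReal (driftW π τ z)
            ∂(empirical (fun k => Ys k ω) n) ∂Pr +
            ∫⁻ ω, ENNReal.ofReal (driftW π τ (Xs n ω)) ∂Pr) := by
        rw [lintegral_add_left (hDn.const_mul _), lintegral_const_mul _ hDn,
          lintegral_const_mul' _ _ ENNReal.ofReal_ne_top, lintegral_add_right _ hXn]
      _ ≤ ENNReal.ofReal (1 - υ) * ENNReal.ofReal (lam * M + b) +
          ENNReal.ofReal υ * (ENNReal.ofReal S + ENNReal.ofReal M) := by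
        gcongr
        exact hemp n
      _ = ENNReal.ofReal (L * M + B) := by
        rw [← ENNReal.ofReal_add hS0 hM0, ← ENNReal.ofReal_mul hυ1.le,
          ← ENNReal.ofReal_mul hυ.1.le, ← ENNReal.ofReal_add (by positivity)
            (mul_nonneg hυ.1.le (by positivity))]
        congr 1
        rw [hL, hB]
        ring
      _ ≤ ENNReal.ofReal M := by
        refine ENNReal.ofReal_le_ofReal ?_
        have : B / (1 - L) ≤ M := le_max_right _ _
        rw [div_le_iff₀ hL1] at this
        linarith

/-- Freezing the auxiliary measure at time `n` changes the law of the state at time `n + j`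
little. -/
lemma abs_integral_sub_integral_frozen_le (hc : Continuous π) (hpos : ∀ x, 0 < π x)
    (hυ : υ ∈ Set.Ioo (0 : ℝ) 1) (hX : IsSampler Pr ℱ P π T υ Xs Ys) (n : ℕ) {f : X → ℝ}
    (hf : Measurable f) {C : ℝ} (hC0 : 0 ≤ C) (hC : ∀ x, |f x| ≤ C) (j i : ℕ) :
    |∫ ω, (stepOp P π T υ (empirical (fun k => Ys k ω) n))^[i] f (Xs (n + j) ω) ∂Pr -
      ∫ ω, (stepOp P π T υ (empirical (fun k => Ys k ω) n))^[i + j] f (Xs n ω) ∂Pr| ≤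
      j * (4 * C * j / (n + 1)) := by
  induction j generalizing i with
  | zero => simp
  | succ j ih =>
    have hY : Measurable fun ω (k : ℕ) => Ys k ω :=
      measurable_pi_iff.2 fun k => measurable_auxiliary hX k
    have hG : ∀ i, Measurable fun p : (ℕ → X) × X =>
        (stepOp P π T υ (empirical p.1 n))^[i] f p.2 := fun i =>
      measurable_stepOp_iterate_prod (P := P) (T := T) hc hpos hυ
      (empiricalKernel X n) hf i
    have hGb : ∀ (i : ℕ) (y : ℕ → X) (x : X), |(stepOp P π T υ (empirical y n))^[i] f x| ≤ C :=
      fun i y x => abs_stepOp_iterate_le hc hpos hυ _ hC i x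
    have hnext := integral_history_next hc hpos hυ hX (n + j)
      (G := fun y => (stepOp P π T υ (empirical y n))^[i] f) (hG i) (hGb i)
    simp only [empirical_history (Nat.le_add_right n j)] at hnext
    rw [← add_assoc n j 1, hnext]
    have hm2 := fun i => measurable_stepOp_iterate_empirical (P := P) (T := T) hc hpos hυ
      (measurable_auxiliary hX) (measurable_state hX (n + j)) hf n i
    have hstep : Measurable fun p : (ℕ → X) × X => stepOp P π T υ (empirical p.1 (n + j))
        ((stepOp P π T υ (empirical p.1 n))^[i] f) p.2 :=
      measurable_stepOp_prod hc hpos hυ (empiricalKernel X (n + j))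
        (φ := fun y => (stepOp P π T υ (empirical y n))^[i] f) (hG i)
    have hm1 : Measurable fun ω => stepOp P π T υ (empirical (fun k => Ys k ω) (n + j))
        ((stepOp P π T υ (empirical (fun k => Ys k ω) n))^[i] f) (Xs (n + j) ω) := by
      have h := hstep.comp (hY.prodMk (measurable_state hX (n + j)))
      exact h
    have hdiff : |∫ ω, stepOp P π T υ (empirical (fun k => Ys k ω) (n + j))
          ((stepOp P π T υ (empirical (fun k => Ys k ω) n))^[i] f) (Xs (n + j) ω) ∂Pr -
        ∫ ω, (stepOp P π T υ (empirical (fun k => Ys k ω) n))^[i + 1] f (Xs (n + j) ω) ∂Pr| ≤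
        4 * C * j / (n + 1) := by
      have hb1 := fun ω => abs_stepOp_le (P := P) (T := T) hc hpos hυ
        (empirical (fun k => Ys k ω) (n + j)) (hGb i fun k => Ys k ω) (Xs (n + j) ω)
      have hb2 := fun ω => hGb (i + 1) (fun k => Ys k ω) (Xs (n + j) ω)
      rw [← integral_sub (integrable_of_abs_le hm1 hb1) (integrable_of_abs_le (hm2 (i + 1)) hb2)]
      refine abs_integral_le_of_abs_le fun ω => ?_
      rw [Function.iterate_succ_apply']
      exact abs_stepOp_empirical_sub_le hc hpos hυ _ n j
        (measurable_stepOp_iterate hc hpos hυ _ hf i) (hGb i _) _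
    have hih := ih (i + 1)
    rw [show i + 1 + j = i + (j + 1) by ring] at hih
    refine (abs_sub_le _ _ _).trans ((add_le_add hdiff hih).trans ?_)
    have hj0 : (0 : ℝ) ≤ j := Nat.cast_nonneg j
    have hle : 4 * C * (j : ℝ) / (n + 1) ≤ 4 * C * ((j + 1 : ℕ) : ℝ) / (n + 1) := by
      push_cast
      gcongr
      linarith
    have := mul_le_mul_of_nonneg_left hle hj0
    push_cast at *
    linarith

end Sampler

section Limit

variable {X : Type*} [TopologicalSpace X] [MeasurableSpace X] [BorelSpace X]
  {μ : Measure X} {π : X → ℝ} {T υ τ : ℝ} {P : Kernel X X} {Ω : Type*} {mΩ : MeasurableSpace Ω}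
  {Pr : Measure Ω} {ℱ : Filtration ℕ mΩ} {Xs Ys : ℕ → Ω → X}

/-- The empirical distribution, as a probability measure. -/
noncomputable def empiricalProb (y : ℕ → X) (n : ℕ) : ProbabilityMeasure X :=
  ⟨empirical y n, isProbabilityMeasure_empirical y n⟩

/-- The tempered target, as a probability measure. -/
noncomputable def temperedProb (hI1 : TargetCondition μ π) (hmass : temperedMass μ π T < ⊤) :
    ProbabilityMeasure X :=
  ⟨temperedTarget μ π T, isProbabilityMeasure_temperedTarget hI1 hmass⟩

/-- Almost surely, the `W`-moments of the empirical distributions are eventually bounded by a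
constant. -/
lemma exists_ae_eventually_lintegral_le (hI1 : TargetCondition μ π) (hτ : 0 < τ)
    (hI3 : AuxiliaryCondition Pr μ π T τ Ys) :
    ∃ D : ℝ, 0 ≤ D ∧ ∀ᵐ ω ∂Pr, ∀ᶠ n in atTop,
      ∫⁻ x, ENNReal.ofReal (driftW π τ x) ∂(empirical (fun k => Ys k ω) n) ≤ ENNReal.ofReal D := by
  have hWc := continuous_driftW (τ := τ) hI1.continuous hI1.pos hI1.bounded
  have hW0 : ∀ x, 0 ≤ driftW π τ x := fun x =>
    zero_le_one.trans (one_le_driftW hI1.pos hI1.bounded hτ x)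
  have hlln := hI3.lln (driftW π τ) hWc ⟨1, fun x => by rw [abs_of_nonneg (hW0 x), one_mul]⟩
  have hI0 : 0 ≤ ∫ x, driftW π τ x ∂(temperedTarget μ π T) := integral_nonneg hW0
  refine ⟨∫ x, driftW π τ x ∂(temperedTarget μ π T) + 1, by linarith, ?_⟩
  filter_upwards [hlln] with ω hω
  filter_upwards [hω.eventually (gt_mem_nhds (lt_add_one _))] with n hn
  have hint : Integrable (driftW π τ) (empirical (fun k => Ys k ω) n) := by
    rw [← lintegral_ofReal_ne_top_iff_integrable hWc.measurable.aestronglyMeasurable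
      (ae_of_all _ hW0), lintegral_empirical _ _ hWc.measurable.ennreal_ofReal]
    exact ENNReal.mul_ne_top (by simp) (ENNReal.sum_ne_top.2 fun k _ => ENNReal.ofReal_ne_top)
  rw [← ofReal_integral_eq_lintegral_ofReal hint (ae_of_all _ hW0)]
  exact ENNReal.ofReal_le_ofReal hn.le

variable [PolishSpace X]

/-- Almost sure weak convergence of the empirical distributions. -/
lemma ae_tendsto_empirical (hI1 : TargetCondition μ π) (hτ : 0 < τ)
    (hmass : temperedMass μ π T < ⊤) (hI3 : AuxiliaryCondition Pr μ π T τ Ys) :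
    ∀ᵐ ω ∂Pr, Tendsto (empiricalProb fun k => Ys k ω) atTop (𝓝 (temperedProb hI1 hmass)) := by
  refine ae_tendsto_probabilityMeasure (θ := fun ω => empiricalProb fun k => Ys k ω) fun f => ?_
  refine hI3.lln f f.continuous ⟨‖f‖, fun x => (f.norm_coe_le_norm x).trans ?_⟩
  exact le_mul_of_one_le_right (norm_nonneg f) (one_le_driftW hI1.pos hI1.bounded hτ x)

variable [IsMarkovKernel P] [IsProbabilityMeasure Pr]

/-- The chain with the auxiliary measure frozen at `θ⋆` converges to the target. -/
lemma tendsto_stepOp_iterate_target (hI1 : TargetCondition μ π)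
    (hmass : temperedMass μ π T < ⊤) (hυ : υ ∈ Set.Ioo (0 : ℝ) 1)
    (hinv : Kernel.Invariant P (target μ π)) {f : X → ℝ} (hf : Measurable f) {C : ℝ}
    (hC : ∀ x, |f x| ≤ C) {ρ β : ℝ} (hρ0 : 0 ≤ ρ) (hρ1 : ρ < 1)
    (hcontr : ∀ (N : ℕ) (x y : X),
      |(stepOp P π T υ (temperedTarget μ π T))^[N] f x -
        (stepOp P π T υ (temperedTarget μ π T))^[N] f y| ≤
        C * ρ ^ N * (2 + β * (driftW π τ x + driftW π τ y))) (x₀ : X) :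
    Tendsto (fun N => (stepOp P π T υ (temperedTarget μ π T))^[N] f x₀) atTop
      (𝓝 (∫ x, f x ∂(target μ π))) := by
  have := isProbabilityMeasure_target hI1
  have := isProbabilityMeasure_temperedTarget hI1 hmass
  set S := fun N => (stepOp P π T υ (temperedTarget μ π T))^[N] f with hS
  have hSm : ∀ N, Measurable (S N) := fun N =>
    measurable_stepOp_iterate hI1.continuous hI1.pos hυ _ hf N
  have hSb : ∀ N x, |S N x| ≤ C := fun N =>
    abs_stepOp_iterate_le hI1.continuous hI1.pos hυ _ hC N
  have hlim : Tendsto (fun N => ∫ x, (S N x₀ - S N x) ∂(target μ π)) atTop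
      (𝓝 (∫ _x, (0 : ℝ) ∂(target μ π))) := by
    refine tendsto_integral_of_dominated_convergence (fun _ => C + C)
      (fun N => (measurable_const.sub (hSm N)).aestronglyMeasurable) (integrable_const _)
      (fun N => ae_of_all _ fun x => (abs_sub _ _).trans (add_le_add (hSb N _) (hSb N _)))
      (ae_of_all _ fun x => ?_)
    refine squeeze_zero_norm (fun N => hcontr N x₀ x) ?_
    simpa using ((tendsto_pow_atTop_nhds_zero_of_lt_one hρ0 hρ1).const_mul C).mul_const
      (2 + β * (driftW π τ x₀ + driftW π τ x))
  have heq : ∀ N, ∫ x, (S N x₀ - S N x) ∂(target μ π) = S N x₀ - ∫ x, f x ∂(target μ π) := by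
    intro N
    rw [integral_sub (integrable_const _) (integrable_of_abs_le (hSm N) (hSb N)),
      integral_stepOp_target hI1 hmass hυ hinv hf hC N]
    simp
  simp only [heq, integral_zero] at hlim
  simpa using hlim.add_const (∫ x, f x ∂(target μ π))

/-- For the chain with frozen auxiliary measure, forgetting of the initial state, on average. -/
lemma abs_integral_frozen_sub_le (hI1 : TargetCondition μ π) (hτ : 0 < τ)
    (hυ : υ ∈ Set.Ioo (0 : ℝ) 1) (hX : IsSampler Pr ℱ P π T υ Xs Ys) {f : X → ℝ}
    (hf : Measurable f) {C : ℝ} (hC0 : 0 ≤ C) (hC : ∀ x, |f x| ≤ C) {ρ β D M : ℝ} (hρ0 : 0 ≤ ρ)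
    (hβ : 0 ≤ β) (hM0 : 0 ≤ M)
    (hcontr : ∀ (θ : Measure X) [IsProbabilityMeasure θ],
      ∫⁻ y, ENNReal.ofReal (driftW π τ y) ∂θ ≤ ENNReal.ofReal D → ∀ (N : ℕ) (x y : X),
        |(stepOp P π T υ θ)^[N] f x - (stepOp P π T υ θ)^[N] f y| ≤
          C * ρ ^ N * (2 + β * (driftW π τ x + driftW π τ y)))
    (N n : ℕ) (hM : ∫⁻ ω, ENNReal.ofReal (driftW π τ (Xs n ω)) ∂Pr ≤ ENNReal.ofReal M) (x₀ : X) :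
    |∫ ω, (stepOp P π T υ (empirical (fun k => Ys k ω) n))^[N] f (Xs n ω) ∂Pr -
      ∫ ω, (stepOp P π T υ (empirical (fun k => Ys k ω) n))^[N] f x₀ ∂Pr| ≤
      C * ρ ^ N * (2 + β * (M + driftW π τ x₀)) + 2 * C * Pr.real {ω | ¬
        ∫⁻ x, ENNReal.ofReal (driftW π τ x) ∂(empirical (fun k => Ys k ω) n) ≤
          ENNReal.ofReal D} := by
  have hW0 : ∀ x, 0 ≤ driftW π τ x := fun x =>
    zero_le_one.trans (one_le_driftW hI1.pos hI1.bounded hτ x)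
  have hWm := (continuous_driftW (τ := τ) hI1.continuous hI1.pos hI1.bounded).measurable
  have hXn := measurable_state hX n
  have hm := fun {Z : Ω → X} (hZ : Measurable Z) => measurable_stepOp_iterate_empirical (P := P)
    (T := T) hI1.continuous hI1.pos hυ (measurable_auxiliary hX) hZ hf n N
  have hGb : ∀ (y : ℕ → X) (x : X), |(stepOp P π T υ (empirical y n))^[N] f x| ≤ C :=
    fun y x => abs_stepOp_iterate_le hI1.continuous hI1.pos hυ _ hC N x
  set E := {ω | ¬ ∫⁻ x, ENNReal.ofReal (driftW π τ x) ∂(empirical (fun k => Ys k ω) n) ≤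
    ENNReal.ofReal D} with hE
  have hEm : MeasurableSet E :=
    (measurableSet_le (measurable_lintegral_empirical (measurable_auxiliary hX) n
      hWm.ennreal_ofReal) measurable_const).compl
  have hWint : Integrable (fun ω => driftW π τ (Xs n ω)) Pr :=
    (lintegral_ofReal_ne_top_iff_integrable (hWm.comp hXn).aestronglyMeasurable
      (ae_of_all _ fun ω => hW0 _)).1 (hM.trans_lt ENNReal.ofReal_lt_top).ne
  have hWM : ∫ ω, driftW π τ (Xs n ω) ∂Pr ≤ M := by
    rw [← ENNReal.ofReal_le_ofReal_iff hM0,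
      ofReal_integral_eq_lintegral_ofReal hWint (ae_of_all _ fun ω => hW0 _)]
    exact hM
  have hb0 : Integrable (fun ω => driftW π τ (Xs n ω) + driftW π τ x₀) Pr :=
    hWint.add (integrable_const _)
  have hb1 : Integrable (fun ω => C * ρ ^ N *
      (2 + β * (driftW π τ (Xs n ω) + driftW π τ x₀))) Pr :=
    ((integrable_const _).add (hb0.const_mul β)).const_mul _
  have hb2 : Integrable (fun ω => 2 * C * E.indicator (1 : Ω → ℝ) ω) Pr :=
    ((integrable_const (1 : ℝ)).indicator hEm).const_mul _
  rw [← integral_sub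
    (integrable_of_abs_le (hm hXn) fun ω => hGb (fun k => Ys k ω) (Xs n ω))
    (integrable_of_abs_le (hm measurable_const) fun ω =>
      hGb (fun k => Ys k ω) x₀)]
  have hpt : ∀ ω, |(stepOp P π T υ (empirical (fun k => Ys k ω) n))^[N] f (Xs n ω) -
      (stepOp P π T υ (empirical (fun k => Ys k ω) n))^[N] f x₀| ≤
      C * ρ ^ N * (2 + β * (driftW π τ (Xs n ω) + driftW π τ x₀)) +
        2 * C * E.indicator (1 : Ω → ℝ) ω := by
    intro ω
    by_cases hω : ω ∈ E
    · have h1 := abs_sub ((stepOp P π T υ (empirical (fun k => Ys k ω) n))^[N] f (Xs n ω))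
        ((stepOp P π T υ (empirical (fun k => Ys k ω) n))^[N] f x₀)
      have h2 : 0 ≤ C * ρ ^ N * (2 + β * (driftW π τ (Xs n ω) + driftW π τ x₀)) := by
        have := hW0 (Xs n ω)
        have := hW0 x₀
        positivity
      rw [Set.indicator_of_mem hω, Pi.one_apply]
      linarith [hGb (fun k => Ys k ω) (Xs n ω), hGb (fun k => Ys k ω) x₀]
    · rw [Set.indicator_of_notMem hω, mul_zero, add_zero]
      exact hcontr _ (not_not.1 hω) N _ _
  rw [← Real.norm_eq_abs]
  refine (norm_integral_le_of_norm_le (hb1.add hb2) (ae_of_all _ fun ω => ?_)).trans ?_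
  · exact hpt ω
  simp only [Pi.add_apply]
  rw [integral_add hb1 hb2, integral_const_mul, integral_const_mul, integral_indicator_one hEm,
    integral_add (integrable_const _) (hb0.const_mul β),
    integral_const_mul, integral_add hWint (integrable_const _)]
  simp only [integral_const, probReal_univ, smul_eq_mul, one_mul]
  gcongr

/-- The chain with auxiliary measure frozen at the empirical distribution converges, on average, to
the chain with auxiliary measure `θ⋆`. -/
lemma tendsto_integral_stepOp_iterate_empirical (hI1 : TargetCondition μ π) (hτ : 0 < τ)
    (hmass : temperedMass μ π T < ⊤) (hυ : υ ∈ Set.Ioo (0 : ℝ) 1) (hP : IsFeller P)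
    (hX : IsSampler Pr ℱ P π T υ Xs Ys) (hI3 : AuxiliaryCondition Pr μ π T τ Ys)
    (f : X →ᵇ ℝ) (N : ℕ) (x₀ : X) :
    Tendsto (fun n => ∫ ω, (stepOp P π T υ (empirical (fun k => Ys k ω) n))^[N] f x₀ ∂Pr) atTop
      (𝓝 ((stepOp P π T υ (temperedTarget μ π T))^[N] f x₀)) := by
  have hlim : Tendsto (fun n => ∫ ω, (stepOp P π T υ (empirical (fun k => Ys k ω) n))^[N] f x₀ ∂Pr)
      atTop (𝓝 (∫ _ω, (stepOp P π T υ (temperedTarget μ π T))^[N] f x₀ ∂Pr)) := by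
    refine tendsto_integral_of_dominated_convergence (fun _ => ‖f‖)
      (fun n => (measurable_stepOp_iterate_empirical hI1.continuous hI1.pos hυ
        (measurable_auxiliary hX) measurable_const f.continuous.measurable n N).aestronglyMeasurable)
      (integrable_const _) (fun n => ae_of_all _ fun ω => ?_) ?_
    · exact abs_stepOp_iterate_le hI1.continuous hI1.pos hυ _ f.norm_coe_le_norm N x₀
    · filter_upwards [ae_tendsto_empirical hI1 hτ hmass hI3] with ω hω
      have h := tendsto_stepOp_iterate (T := T) hI1.continuous hI1.pos hυ hP hω f N x₀
      exact h
  simpa using hlim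

lemma tendsto_measureReal_compl_of_ae_eventually {p : Ω → ℕ → Prop}
    (hp : ∀ n, MeasurableSet {ω | ¬ p ω n}) (h : ∀ᵐ ω ∂Pr, ∀ᶠ n in atTop, p ω n) :
    Tendsto (fun n => Pr.real {ω | ¬ p ω n}) atTop (𝓝 0) := by
  have hlim : Tendsto (fun n => ∫ ω, {ω | ¬ p ω n}.indicator (1 : Ω → ℝ) ω ∂Pr) atTop
      (𝓝 (∫ _ω, (0 : ℝ) ∂Pr)) := by
    refine tendsto_integral_of_dominated_convergence (fun _ => 1)
      (fun n => (measurable_one.indicator (hp n)).aestronglyMeasurable) (integrable_const _)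
      (fun n => ae_of_all _ fun ω => ?_) ?_
    · by_cases hω : ω ∈ {ω | ¬ p ω n}
      · rw [Set.indicator_of_mem hω]
        simp
      · rw [Set.indicator_of_notMem hω]
        simp
    · filter_upwards [h] with ω hω
      refine tendsto_const_nhds.congr' ?_
      filter_upwards [hω] with n hn
      rw [Set.indicator_of_notMem (by simpa using hn)]
  simpa only [integral_indicator_one (hp _), integral_zero] using hlim

end Limit

end InteractingTempering

theorem theorem3p4 {X : Type*} [TopologicalSpace X] [PolishSpace X] [MeasurableSpace X]
    [BorelSpace X] (μ : Measure X) (π : X → ℝ) (T υ τ : ℝ) (P : Kernel X X) [IsMarkovKernel P]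
    {Ω : Type*} {mΩ : MeasurableSpace Ω} (Pr : Measure Ω) [IsProbabilityMeasure Pr]
    (ℱ : Filtration ℕ mΩ) (Xs Ys : ℕ → Ω → X)
    (hT : 1 < T) (hυ : υ ∈ Set.Ioo (0 : ℝ) 1) (hτ : τ ∈ Set.Ioo (0 : ℝ) (1 / T))
    (hmass : InteractingTempering.temperedMass μ π T < ⊤)
    (hX : InteractingTempering.IsSampler Pr ℱ P π T υ Xs Ys)
    (hI1 : InteractingTempering.TargetCondition μ π)
    (hI2 : InteractingTempering.KernelCondition μ π τ P)
    (hI3 : InteractingTempering.AuxiliaryCondition Pr μ π T τ Ys)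
    (hX0 : ∫⁻ ω, ENNReal.ofReal (InteractingTempering.driftW π τ (Xs 0 ω)) ∂Pr < ⊤)
    (f : X →ᵇ ℝ) :
    Tendsto (fun n => ∫ ω, f (Xs n ω) ∂Pr) atTop
      (𝓝 (∫ x, f x ∂(InteractingTempering.target μ π))) := by
  open InteractingTempering in
  have := isProbabilityMeasure_temperedTarget hI1 hmass
  have hΩ := nonempty_of_isProbabilityMeasure Pr
  let x₀ : X := Xs 0 hΩ.some
  have : Nonempty X := ⟨x₀⟩
  have hf : Measurable f := f.continuous.measurable
  have hC : ∀ x, |f x| ≤ ‖f‖ := f.norm_coe_le_norm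
  have hC0 : 0 ≤ ‖f‖ := norm_nonneg f
  obtain ⟨lam, b', hlam, hlam1, hdrift'⟩ := hI2.drift
  set b := max b' 0
  have hb : 0 ≤ b := le_max_right _ _
  have hdrift : ∀ x, ∫⁻ y, ENNReal.ofReal (driftW π τ y) ∂(P x) ≤
      ENNReal.ofReal (lam * driftW π τ x + b) := fun x =>
    (hdrift' x).trans (ENNReal.ofReal_le_ofReal (by gcongr; exact le_max_left _ _))
  obtain ⟨M, hM0, hM⟩ := exists_moment_bound hI1 hτ.1 hlam hlam1 hb hdrift hυ hX hI3.moment_W hX0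
  obtain ⟨D₁, hD₁, hae⟩ := exists_ae_eventually_lintegral_le hI1 hτ.1 hI3
  set D := max D₁ (∫⁻ x, ENNReal.ofReal (driftW π τ x) ∂(temperedTarget μ π T)).toReal
  have hD0 : 0 ≤ D := hD₁.trans (le_max_left _ _)
  have hD₂ : ∫⁻ x, ENNReal.ofReal (driftW π τ x) ∂(temperedTarget μ π T) ≤ ENNReal.ofReal D := by
    rw [← ENNReal.ofReal_toReal hI3.tempered_W.ne]
    exact ENNReal.ofReal_le_ofReal (le_max_right _ _)
  obtain ⟨ρ, β, hρ0, hρ1, hβ, hcontr⟩ := exists_geometric_contraction (T := T) hI1 hτ.1 hυ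
    hI2.levelSets hlam hlam1 hb hdrift hD0
  have hWm := (continuous_driftW (τ := τ) hI1.continuous hI1.pos hI1.bounded).measurable
  have hbad : Tendsto (fun n => Pr.real {ω | ¬
      ∫⁻ x, ENNReal.ofReal (driftW π τ x) ∂(empirical (fun k => Ys k ω) n) ≤ ENNReal.ofReal D})
      atTop (𝓝 0) := by
    refine tendsto_measureReal_compl_of_ae_eventually (fun n => ?_) ?_
    · exact (measurableSet_le (measurable_lintegral_empirical (measurable_auxiliary hX) n
        hWm.ennreal_ofReal) measurable_const).compl
    · filter_upwards [hae] with ω hω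
      filter_upwards [hω] with n hn
      exact hn.trans (ENNReal.ofReal_le_ofReal (le_max_left _ _))
  rw [Metric.tendsto_atTop']
  intro ε hε
  have h1 : Tendsto (fun N : ℕ => ‖f‖ * ρ ^ N * (2 + β * (M + driftW π τ x₀))) atTop (𝓝 0) := by
    simpa using ((tendsto_pow_atTop_nhds_zero_of_lt_one hρ0 hρ1).const_mul ‖f‖).mul_const
      (2 + β * (M + driftW π τ x₀))
  have h2 := tendsto_stepOp_iterate_target hI1 hmass hυ hI2.invariant hf hC hρ0 hρ1
    (hcontr _ hD₂ f ‖f‖ hf hC) x₀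
  obtain ⟨N, hN1, hN2⟩ := ((h1.eventually (gt_mem_nhds (show 0 < ε / 5 by positivity))).and
    (h2.eventually (Metric.ball_mem_nhds _ (show 0 < ε / 5 by positivity)))).exists
  have h3 : Tendsto (fun n : ℕ => (N : ℝ) * (4 * ‖f‖ * N / ((n : ℝ) + 1))) atTop (𝓝 0) := by
    have := (tendsto_one_div_add_atTop_nhds_zero_nat (𝕜 := ℝ)).const_mul ((N : ℝ) * (4 * ‖f‖ * N))
    rw [mul_zero] at this
    refine this.congr fun n => ?_
    ring
  have h4 : Tendsto (fun n => 2 * ‖f‖ * Pr.real {ω | ¬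
      ∫⁻ x, ENNReal.ofReal (driftW π τ x) ∂(empirical (fun k => Ys k ω) n) ≤ ENNReal.ofReal D})
      atTop (𝓝 0) := by
    simpa using hbad.const_mul (2 * ‖f‖)
  have h5 := tendsto_integral_stepOp_iterate_empirical hI1 hτ.1 hmass hυ hI2.feller hX hI3 f N x₀
  obtain ⟨n₀, hn₀⟩ := eventually_atTop.1 (((h3.eventually (gt_mem_nhds
    (show 0 < ε / 5 by positivity))).and (h4.eventually (gt_mem_nhds
    (show 0 < ε / 5 by positivity)))).and
    (h5.eventually (Metric.ball_mem_nhds _ (show 0 < ε / 5 by positivity))))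
  refine ⟨n₀ + N, fun m hm => ?_⟩
  obtain ⟨n, rfl⟩ : ∃ n, m = n + N := ⟨m - N, by omega⟩
  obtain ⟨⟨hn3, hn4⟩, hn5⟩ := hn₀ n (by omega)
  have e1 := abs_integral_sub_integral_frozen_le hI1.continuous hI1.pos hυ hX n hf hC0 hC N 0
  have e2 := abs_integral_frozen_sub_le hI1 hτ.1 hυ hX hf hC0 hC hρ0 hβ.le hM0
    (fun θ _ h => hcontr θ h f ‖f‖ hf hC) N n (hM n) x₀
  rw [Real.dist_eq] at hN2 hn5
  rw [zero_add] at e1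
  simp only [Function.iterate_zero, id_eq] at e1
  rw [Real.dist_eq, abs_lt]
  rw [abs_le] at e1 e2
  rw [abs_lt] at hN2 hn5
  constructor <;> linarith [e1.1, e1.2, e2.1, e2.2, hN2.1, hN2.2, hn5.1, hn5.2]
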